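/- **Theorem (Logical Graduality).** If $\Gamma_1\sqsubseteq\Gamma_2\vdash t_1\sqsubseteq t_2:A_1\sqsubseteq A_2$ is derivable in the gradual cast calculus $\lambda_G$, then $\Gamma_1\sqsubseteq\Gamma_2\vDash [\![t_1]\!]\sqsubseteq[\![t_2]\!]:A_1\sqsubseteq A_2$ holds in the typed language $\lambda_{T,\mho}$. That is, $[\![t_k]\!]$ has type $[\![A_k]\!]$ in $[\![\Gamma_k]\!]$ ($k=1,2$), $\Gamma_1\sqsubseteq\Gamma_2$, $A_1\sqsubseteq A_2$, and, writing $\Gamma_k=x_{k,1}:A_{k,1},\dots,x_{k,n}:A_{k,n}$, $$[\![\Gamma_1]\!]\vDash E_{e,A_1,A_2}[\,[\![t_1]\!]\,]\ \sqsubseteq\ \mathsf{let}\,x_{2,1}=E_{e,A_{1,1},A_{2,1}}[x_{1,1}]\,\mathsf{in}\cdots\mathsf{let}\,x_{2,n}=E_{e,A_{1,n},A_{2,n}}[x_{1,n}]\,\mathsf{in}\,[\![t_2]\!]\ :\ [\![A_2]\!].$$ The notions are as follows. *$\lambda_G$.* Types: $?,\ 1,\ A\times B,\ A+B,\ A\to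 B$. Tags $G$: $1,\ ?\times?,\ ?+?,\ ?\to?$; $\lfloor A\rfloor$ is the tag with the same outermost connective as $A\ne{?}$. Terms: $\mho$, variables, casts $\langle B\Leftarrow A\rangle t$, $()$, pairs, pair matching, the injections $\mathsf{inj},\mathsf{inj}'$, case, $\lambda(x:A).t$, application. *Syntactic dynamism.* $A\sqsubseteq B$ is the least reflexive transitive relation on types with greatest element $?$ for which $\times,+,\to$ are monotone in both arguments. $\Gamma_1\sqsubseteq\Gamma_2$ means equal length and pointwise $\sqsubseteq$. The judgement $\Gamma_1\sqsubseteq\Gamma_2\vdash t_1\sqsubseteq t_2:A_1\sqsubseteq A_2$ is generated by: the congruence rule of every term former other than $\mho$, i.e. its typing rule read on both sides at once, with $\Gamma_1\sqsubseteq\Gamma_2$ as a premise for variables and $()$, and with the unused summand types required to be related by $\sqsubseteq$ for the injections; for casts, from $\Gamma_1\sqsubseteq\Gamma_2\vdash t_1\sqsubseteq t_2:A_1\sqsubseteq A_2$ and $B_1\sqsubseteq B_2$ infer $\Gamma_1\sqsubseteq\Gamma_2\vdash\langle B_1\Leftarrow A_1\rangle t_1\sqsubseteq\langle B_2\Leftarrow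 A_2\rangle t_2:B_1\sqsubseteq B_2$. *$\lambda_{T,\mho}$.* The call-by-value, left-to-right, simply typed $\lambda$-calculus with $\mathsf{let}$, unit, products (eliminated by pair matching), sums, functions, iso-recursive types $\mu\alpha.A$ with $\mathsf{roll}_{\mu\alpha.A}$ and $\mathsf{unroll}$, and an error $\mho$ of every type. Small steps carry weights: $E[\mathsf{unroll}(\mathsf{roll}\,v)]\mapsto^1E[v]$; the other $\beta$-reductions (in an evaluation context) and $E[\mho]\mapsto\mho$ have weight $0$. $t\Rightarrow^i t'$ means that $t$ reduces to $t'$ in finitely many steps of total weight $i$, and $t\Rightarrow t'$ that this holds for some $i$. *Translation.* $[\![?]\!]=\mu\alpha.\,1+((\alpha\times\alpha)+((\alpha+\alpha)+(\alpha\to\alpha)))$, and $[\![\cdot]\!]$ preserves all other type formers. On terms, $[\![\langle B\Leftarrow A\rangle t]\!]=E_{A\Rightarrow B}[[\![t]\!]]$ and all other term formers are preserved. For evaluation contexts let $E\times E'=\mathsf{let}\,(x,x')=[\cdot]\,\mathsf{in}\,(E[x],E'[x'])$, $E+E'=\mathsf{case}\,[\cdot]\,\{\mathsf{inj}\,x.\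 \mathsf{inj}\,E[x]\mid\mathsf{inj}'x'.\ \mathsf{inj}'E'[x']\}$, $E\to E'=\mathsf{let}\,f=[\cdot]\,\mathsf{in}\,\lambda a.\,E'[f\,(E[a])]$, where $a$ has the input type of $E$. Let $\mathrm{tag}_G=\mathsf{roll}(\mathsf{in}_G[\cdot])$, with $\mathsf{in}_G$ the injection of the summand of $G$, and let $\mathrm{untag}_G$ be the context that unrolls and matches on the sum, returning the content $x$ in the summand of $G$ and $\mho$ in the other summands. Then $E_{?\Rightarrow?}=E_{1\Rightarrow1}=[\cdot]$; $E_{A_1\star B_1\Rightarrow A_2\star B_2}=E_{A_1\Rightarrow A_2}\star E_{B_1\Rightarrow B_2}$ for $\star\in\{\times,+\}$; $E_{A_1\to B_1\Rightarrow A_2\to B_2}=E_{A_2\Rightarrow A_1}\to E_{B_1\Rightarrow B_2}$; $E_{G\Rightarrow?}=\mathrm{tag}_G$ and $E_{?\Rightarrow G}=\mathrm{untag}_G$; $E_{A\Rightarrow?}=E_{\lfloor A\rfloor\Rightarrow?}[E_{A\Rightarrow\lfloor A\rfloor}]$ and $E_{?\Rightarrow A}=E_{\lfloor A\rfloor\Rightarrow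 A}[E_{?\Rightarrow\lfloor A\rfloor}]$ for $A\ne{?},\lfloor A\rfloor$; and $E_{A\Rightarrow B}=\mathsf{let}\,x=[\cdot]\,\mathsf{in}\,\mho$ for $A,B\ne{?}$ with $\lfloor A\rfloor\ne\lfloor B\rfloor$. *Upcasts.* Canonical derivations $c:A\sqsubseteq B$ are built from $\mathrm{id}(1):1\sqsubseteq1$, $\mathrm{id}(?):{?}\sqsubseteq{?}$, $\mathrm{tag}(\lfloor A\rfloor)\circ c:A\sqsubseteq{?}$ for $A\neq{?}$ and $c:A\sqsubseteq\lfloor A\rfloor$, and $c\times d$, $c+d$, $c\to d$. Whenever $A\sqsubseteq B$ there is exactly one. It denotes an embedding $E_{e,c}$ and a projection $E_{p,c}$: both are $[\cdot]$ for $\mathrm{id}$; $E_{e,\mathrm{tag}(G)\circ c}=\mathrm{tag}_G[E_{e,c}]$ and $E_{p,\mathrm{tag}(G)\circ c}=E_{p,c}[\mathrm{untag}_G]$; and for $m\in\{e,p\}$ with complementary mode $\bar m$, $E_{m,c\star d}=E_{m,c}\star E_{m,d}$ for $\star\in\{\times,+\}$ and $E_{m,c\to d}=E_{\bar m,c}\to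 E_{m,d}$. Put $E_{e,A,B}=E_{e,c}$. *Logical error approximation.* For $i\in\mathbb N$ and a closed type $A$ define relations $\preceq^i_A$, $\succeq^i_A$ on closed terms of type $A$, and corresponding relations on closed values of type $A$. On terms: - $t_1\preceq^i_A t_2$ iff $t_1\Rightarrow^{i+1}t_1'$ for some $t_1'$; or $t_1\Rightarrow^j\mho$ for some $j\le i$; or, for some $j\le i$, $t_1\Rightarrow^jv_1$ and $t_2\Rightarrow v_2$ with values $v_1,v_2$ that are $\preceq$-related at index $i-j$. - $t_1\succeq^i_A t_2$ iff $t_2\Rightarrow^{i+1}t_2'$ for some $t_2'$; or $t_2\Rightarrow^j\mho$ for some $j\le i$ and $t_1\Rightarrow\mho$; or, for some $j\le i$ and a value $v_2$, $t_2\Rightarrow^jv_2$ and either $t_1\Rightarrow\mho$ or $t_1\Rightarrow v_1$ with $v_1,v_2$ that are $\succeq$-related at index $i-j$. On values, in both cases: at $\mu\alpha.A$ any two values are related at index $0$, and $\mathsf{roll}\,v_1,\mathsf{roll}\,v_2$ are related at $i+1$ iff $v_1,v_2$ are related at index $i$ and type $A[\mu\alpha.A/\alpha]$; $()$ is related to $()$;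 pairs are related componentwise; values of sum type are related iff they are the same injection of related values; $v_1,v_2$ are related at index $i$ and type $A\to B$ iff for all $j\le i$ and all $w_1,w_2$ related at index $j$ and type $A$, the terms $v_1\,w_1$ and $v_2\,w_2$ are related at index $j$ and type $B$. Finally $\Gamma\vDash t_1\sqsubseteq t_2:A$ means that $t_1,t_2$ have type $A$ in $\Gamma$ and that, for each of the two families and every $i$, $t_1[\gamma_1]$ and $t_2[\gamma_2]$ are related at index $i$ for all closing value substitutions $\gamma_1,\gamma_2$ that are pointwise related at index $i$. -/

import Mathlib

namespace Graduality

/-! ## The gradual cast calculus: syntax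

Variables are de Bruijn indices; environments are lists whose head is the most recently bound
variable. -/

/-- Types of the cast calculus: `?`, `1`, `A × B`, `A + B`, `A → B`. -/
inductive GTy : Type
  | dyn : GTy
  | unit : GTy
  | prod : GTy → GTy → GTy
  | sum : GTy → GTy → GTy
  | arr : GTy → GTy → GTy
  deriving DecidableEq

/-- The tags `1`, `? × ?`, `? + ?`, `? → ?`. -/
inductive Tag : Type
  | unit | prod | sum | arr
  deriving DecidableEq

/-- The type that a tag stands for. -/
def Tag.ty : Tag → GTy
  | .unit => .unit
  | .prod => .prod .dyn .dyn
  | .sum => .sum .dyn .dyn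
  | .arr => .arr .dyn .dyn

/-- The underlying tag of a type; `?` has none. -/
def GTy.tag? : GTy → Option Tag
  | .dyn => none
  | .unit => some .unit
  | .prod _ _ => some .prod
  | .sum _ _ => some .sum
  | .arr _ _ => some .arr

/-- Terms of the cast calculus. `cast A B t` casts `t` from `A` to `B`. The body of `letpair`
binds two variables: the first component has index `1`, the second has index `0`. -/
inductive GTm : Type
  | err : GTm
  | var : ℕ → GTm
  | cast : GTy → GTy → GTm → GTm
  | unit : GTm
  | pair : GTm → GTm → GTm
  | letpair : GTm → GTm → GTm
  | inl : GTm → GTm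
  | inr : GTm → GTm
  | case : GTm → GTm → GTm → GTm
  | lam : GTy → GTm → GTm
  | app : GTm → GTm → GTm

/-! ## Type, environment and term dynamism -/

/-- Type dynamism `A ⊑ B`: the least reflexive and transitive relation with greatest element `?`
for which every type constructor is monotone. -/
inductive TyDyn : GTy → GTy → Prop
  | refl (A : GTy) : TyDyn A A
  | trans {A B C : GTy} : TyDyn A B → TyDyn B C → TyDyn A C
  | top (A : GTy) : TyDyn A .dyn
  | sum {A₁ A₂ B₁ B₂ : GTy} : TyDyn A₁ A₂ → TyDyn B₁ B₂ → TyDyn (.sum A₁ B₁) (.sum A₂ B₂)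
  | prod {A₁ A₂ B₁ B₂ : GTy} : TyDyn A₁ A₂ → TyDyn B₁ B₂ → TyDyn (.prod A₁ B₁) (.prod A₂ B₂)
  | arr {A₁ A₂ B₁ B₂ : GTy} : TyDyn A₁ A₂ → TyDyn B₁ B₂ → TyDyn (.arr A₁ B₁) (.arr A₂ B₂)

/-- Environment dynamism: equal lengths and pointwise type dynamism. -/
inductive EnvDyn : List GTy → List GTy → Prop
  | nil : EnvDyn [] []
  | cons {Γ₁ Γ₂ : List GTy} {A₁ A₂ : GTy} :
      EnvDyn Γ₁ Γ₂ → TyDyn A₁ A₂ → EnvDyn (A₁ :: Γ₁) (A₂ :: Γ₂)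

/-- Syntactic term dynamism: `TermDyn Γ₁ Γ₂ t₁ t₂ A₁ A₂` is `Γ₁ ⊑ Γ₂ ⊢ t₁ ⊑ t₂ : A₁ ⊑ A₂`. -/
inductive TermDyn : List GTy → List GTy → GTm → GTm → GTy → GTy → Prop
  | cast {Γ₁ Γ₂ : List GTy} {t₁ t₂ : GTm} {A₁ A₂ B₁ B₂ : GTy} :
      TermDyn Γ₁ Γ₂ t₁ t₂ A₁ A₂ → TyDyn B₁ B₂ →
      TermDyn Γ₁ Γ₂ (.cast A₁ B₁ t₁) (.cast A₂ B₂ t₂) B₁ B₂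
  | var {Γ₁ Γ₂ : List GTy} {n : ℕ} {A₁ A₂ : GTy} :
      EnvDyn Γ₁ Γ₂ → Γ₁[n]? = some A₁ → Γ₂[n]? = some A₂ →
      TermDyn Γ₁ Γ₂ (.var n) (.var n) A₁ A₂
  | unit {Γ₁ Γ₂ : List GTy} : EnvDyn Γ₁ Γ₂ → TermDyn Γ₁ Γ₂ .unit .unit .unit .unit
  | pair {Γ₁ Γ₂ : List GTy} {t₁ t₂ t₁' t₂' : GTm} {A₁ A₂ A₁' A₂' : GTy} :
      TermDyn Γ₁ Γ₂ t₁ t₂ A₁ A₂ → TermDyn Γ₁ Γ₂ t₁' t₂' A₁' A₂' →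
      TermDyn Γ₁ Γ₂ (.pair t₁ t₁') (.pair t₂ t₂') (.prod A₁ A₁') (.prod A₂ A₂')
  | letpair {Γ₁ Γ₂ : List GTy} {t₁ t₂ s₁ s₂ : GTm} {A₁ A₂ A₁' A₂' B₁ B₂ : GTy} :
      TermDyn Γ₁ Γ₂ t₁ t₂ (.prod A₁ A₁') (.prod A₂ A₂') →
      TermDyn (A₁' :: A₁ :: Γ₁) (A₂' :: A₂ :: Γ₂) s₁ s₂ B₁ B₂ →
      TermDyn Γ₁ Γ₂ (.letpair t₁ s₁) (.letpair t₂ s₂) B₁ B₂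
  | inl {Γ₁ Γ₂ : List GTy} {t₁ t₂ : GTm} {A₁ A₂ A₁' A₂' : GTy} :
      TermDyn Γ₁ Γ₂ t₁ t₂ A₁ A₂ → TyDyn A₁' A₂' →
      TermDyn Γ₁ Γ₂ (.inl t₁) (.inl t₂) (.sum A₁ A₁') (.sum A₂ A₂')
  | inr {Γ₁ Γ₂ : List GTy} {t₁ t₂ : GTm} {A₁ A₂ A₁' A₂' : GTy} :
      TermDyn Γ₁ Γ₂ t₁ t₂ A₁' A₂' → TyDyn A₁ A₂ →
      TermDyn Γ₁ Γ₂ (.inr t₁) (.inr t₂) (.sum A₁ A₁') (.sum A₂ A₂')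
  | case {Γ₁ Γ₂ : List GTy} {t₁ t₂ s₁ s₂ s₁' s₂' : GTm} {A₁ A₂ A₁' A₂' B₁ B₂ : GTy} :
      TermDyn Γ₁ Γ₂ t₁ t₂ (.sum A₁ A₁') (.sum A₂ A₂') →
      TermDyn (A₁ :: Γ₁) (A₂ :: Γ₂) s₁ s₂ B₁ B₂ →
      TermDyn (A₁' :: Γ₁) (A₂' :: Γ₂) s₁' s₂' B₁ B₂ →
      TermDyn Γ₁ Γ₂ (.case t₁ s₁ s₁') (.case t₂ s₂ s₂') B₁ B₂
  | lam {Γ₁ Γ₂ : List GTy} {t₁ t₂ : GTm} {A₁ A₂ B₁ B₂ : GTy} :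
      TermDyn (A₁ :: Γ₁) (A₂ :: Γ₂) t₁ t₂ B₁ B₂ →
      TermDyn Γ₁ Γ₂ (.lam A₁ t₁) (.lam A₂ t₂) (.arr A₁ B₁) (.arr A₂ B₂)
  | app {Γ₁ Γ₂ : List GTy} {t₁ t₂ s₁ s₂ : GTm} {A₁ A₂ B₁ B₂ : GTy} :
      TermDyn Γ₁ Γ₂ t₁ t₂ (.arr A₁ B₁) (.arr A₂ B₂) → TermDyn Γ₁ Γ₂ s₁ s₂ A₁ A₂ →
      TermDyn Γ₁ Γ₂ (.app t₁ s₁) (.app t₂ s₂) B₁ B₂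

/-! ## The typed language with errors -/

/-- Types of the typed language with at most `n` free type variables; `Ty 0` are the closed
types. -/
inductive Ty : ℕ → Type
  | var {n : ℕ} : Fin n → Ty n
  | mu {n : ℕ} : Ty (n + 1) → Ty n
  | unit {n : ℕ} : Ty n
  | prod {n : ℕ} : Ty n → Ty n → Ty n
  | sum {n : ℕ} : Ty n → Ty n → Ty n
  | arr {n : ℕ} : Ty n → Ty n → Ty n

/-- Renaming of type variables. -/
def Ty.rename : {n m : ℕ} → (Fin n → Fin m) → Ty n → Ty m
  | _, _, ρ, .var k => .var (ρ k)
  | _, _, ρ, .mu A => .mu (A.rename (Fin.cases 0 fun k => (ρ k).succ))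
  | _, _, _, .unit => .unit
  | _, _, ρ, .prod A B => .prod (A.rename ρ) (B.rename ρ)
  | _, _, ρ, .sum A B => .sum (A.rename ρ) (B.rename ρ)
  | _, _, ρ, .arr A B => .arr (A.rename ρ) (B.rename ρ)

/-- Simultaneous capture-avoiding substitution of types for type variables. -/
def Ty.subst : {n m : ℕ} → (Fin n → Ty m) → Ty n → Ty m
  | _, _, σ, .var k => σ k
  | _, _, σ, .mu A => .mu (A.subst (Fin.cases (.var 0) fun k => (σ k).rename Fin.succ))
  | _, _, _, .unit => .unit
  | _, _, σ, .prod A B => .prod (A.subst σ) (B.subst σ)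
  | _, _, σ, .sum A B => .sum (A.subst σ) (B.subst σ)
  | _, _, σ, .arr A B => .arr (A.subst σ) (B.subst σ)

/-- The unfolding `A[μα.A/α]` of `μα.A`. -/
def Ty.unfold (A : Ty 1) : Ty 0 := A.subst fun _ => .mu A

/-- Terms of the typed language. `letin t s` binds one variable in `s`; in `letpair t s` the first
component has index `1` and the second has index `0` in `s`. -/
inductive Tm : Type
  | err : Tm
  | var : ℕ → Tm
  | letin : Tm → Tm → Tm
  | roll : Ty 0 → Tm → Tm
  | unroll : Tm → Tm
  | unit : Tm
  | pair : Tm → Tm → Tm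
  | letpair : Tm → Tm → Tm
  | inl : Tm → Tm
  | inr : Tm → Tm
  | case : Tm → Tm → Tm → Tm
  | lam : Ty 0 → Tm → Tm
  | app : Tm → Tm → Tm

/-- Extension of a renaming under a binder. -/
def upRen (ρ : ℕ → ℕ) : ℕ → ℕ
  | 0 => 0
  | n + 1 => ρ n + 1

/-- Renaming of term variables. -/
def Tm.rename (ρ : ℕ → ℕ) : Tm → Tm
  | .err => .err
  | .var n => .var (ρ n)
  | .letin t s => .letin (t.rename ρ) (s.rename (upRen ρ))
  | .roll A t => .roll A (t.rename ρ)
  | .unroll t => .unroll (t.rename ρ)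
  | .unit => .unit
  | .pair t s => .pair (t.rename ρ) (s.rename ρ)
  | .letpair t s => .letpair (t.rename ρ) (s.rename (upRen (upRen ρ)))
  | .inl t => .inl (t.rename ρ)
  | .inr t => .inr (t.rename ρ)
  | .case t s s' => .case (t.rename ρ) (s.rename (upRen ρ)) (s'.rename (upRen ρ))
  | .lam A t => .lam A (t.rename (upRen ρ))
  | .app t s => .app (t.rename ρ) (s.rename ρ)

/-- Extension of a substitution under a binder. -/
def up (σ : ℕ → Tm) : ℕ → Tm
  | 0 => .var 0
  | n + 1 => (σ n).rename Nat.succ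

/-- Simultaneous capture-avoiding substitution. -/
def Tm.subst (σ : ℕ → Tm) : Tm → Tm
  | .err => .err
  | .var n => σ n
  | .letin t s => .letin (t.subst σ) (s.subst (up σ))
  | .roll A t => .roll A (t.subst σ)
  | .unroll t => .unroll (t.subst σ)
  | .unit => .unit
  | .pair t s => .pair (t.subst σ) (s.subst σ)
  | .letpair t s => .letpair (t.subst σ) (s.subst (up (up σ)))
  | .inl t => .inl (t.subst σ)
  | .inr t => .inr (t.subst σ)
  | .case t s s' => .case (t.subst σ) (s.subst (up σ)) (s'.subst (up σ))
  | .lam A t => .lam A (t.subst (up σ))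
  | .app t s => .app (t.subst σ) (s.subst σ)

/-- The substitution `[v/x]` for the most recent variable `x`. -/
def single (v : Tm) : ℕ → Tm
  | 0 => v
  | n + 1 => .var n

/-- The substitution `[v₁/x₁, v₂/x₂]` for the two most recent variables `x₁, x₂`. -/
def double (v₁ v₂ : Tm) : ℕ → Tm
  | 0 => v₂
  | 1 => v₁
  | n + 2 => .var n

/-- Typing. -/
inductive HasTy : List (Ty 0) → Tm → Ty 0 → Prop
  | err {Γ : List (Ty 0)} {A : Ty 0} : HasTy Γ .err A
  | var {Γ : List (Ty 0)} {n : ℕ} {A : Ty 0} : Γ[n]? = some A → HasTy Γ (.var n) A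
  | letin {Γ : List (Ty 0)} {t s : Tm} {A B : Ty 0} :
      HasTy Γ t A → HasTy (A :: Γ) s B → HasTy Γ (.letin t s) B
  | roll {Γ : List (Ty 0)} {t : Tm} {A : Ty 1} :
      HasTy Γ t A.unfold → HasTy Γ (.roll (.mu A) t) (.mu A)
  | unroll {Γ : List (Ty 0)} {t : Tm} {A : Ty 1} :
      HasTy Γ t (.mu A) → HasTy Γ (.unroll t) A.unfold
  | unit {Γ : List (Ty 0)} : HasTy Γ .unit .unit
  | pair {Γ : List (Ty 0)} {t s : Tm} {A B : Ty 0} :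
      HasTy Γ t A → HasTy Γ s B → HasTy Γ (.pair t s) (.prod A B)
  | letpair {Γ : List (Ty 0)} {t s : Tm} {A₁ A₂ B : Ty 0} :
      HasTy Γ t (.prod A₁ A₂) → HasTy (A₂ :: A₁ :: Γ) s B → HasTy Γ (.letpair t s) B
  | inl {Γ : List (Ty 0)} {t : Tm} {A A' : Ty 0} : HasTy Γ t A → HasTy Γ (.inl t) (.sum A A')
  | inr {Γ : List (Ty 0)} {t : Tm} {A A' : Ty 0} : HasTy Γ t A' → HasTy Γ (.inr t) (.sum A A')
  | case {Γ : List (Ty 0)} {t s s' : Tm} {A A' B : Ty 0} :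
      HasTy Γ t (.sum A A') → HasTy (A :: Γ) s B → HasTy (A' :: Γ) s' B →
      HasTy Γ (.case t s s') B
  | lam {Γ : List (Ty 0)} {t : Tm} {A B : Ty 0} :
      HasTy (A :: Γ) t B → HasTy Γ (.lam A t) (.arr A B)
  | app {Γ : List (Ty 0)} {t s : Tm} {A B : Ty 0} :
      HasTy Γ t (.arr A B) → HasTy Γ s A → HasTy Γ (.app t s) B

/-- Values. -/
inductive IsValue : Tm → Prop
  | var (n : ℕ) : IsValue (.var n)
  | roll {v : Tm} (A : Ty 0) : IsValue v → IsValue (.roll A v)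
  | unit : IsValue .unit
  | pair {v w : Tm} : IsValue v → IsValue w → IsValue (.pair v w)
  | inl {v : Tm} : IsValue v → IsValue (.inl v)
  | inr {v : Tm} : IsValue v → IsValue (.inr v)
  | lam (A : Ty 0) (t : Tm) : IsValue (.lam A t)

/-- Evaluation contexts (left to right, call by value). The hole is never under a binder. -/
inductive ECtx : Type
  | hole : ECtx
  | letin : ECtx → Tm → ECtx
  | roll : Ty 0 → ECtx → ECtx
  | unroll : ECtx → ECtx
  | pairL : ECtx → Tm → ECtx
  | pairR : (v : Tm) → IsValue v → ECtx → ECtx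
  | letpair : ECtx → Tm → ECtx
  | inl : ECtx → ECtx
  | inr : ECtx → ECtx
  | case : ECtx → Tm → Tm → ECtx
  | appL : ECtx → Tm → ECtx
  | appR : (v : Tm) → IsValue v → ECtx → ECtx

/-- `E.plug t` is `E[t]`. -/
def ECtx.plug : ECtx → Tm → Tm
  | .hole, t => t
  | .letin E s, t => .letin (E.plug t) s
  | .roll A E, t => .roll A (E.plug t)
  | .unroll E, t => .unroll (E.plug t)
  | .pairL E s, t => .pair (E.plug t) s
  | .pairR v _ E, t => .pair v (E.plug t)
  | .letpair E s, t => .letpair (E.plug t) s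
  | .inl E, t => .inl (E.plug t)
  | .inr E, t => .inr (E.plug t)
  | .case E s s', t => .case (E.plug t) s s'
  | .appL E s, t => .app (E.plug t) s
  | .appR v _ E, t => .app v (E.plug t)

/-- `E.comp F` is the composite context `E[F[·]]`. -/
def ECtx.comp : ECtx → ECtx → ECtx
  | .hole, F => F
  | .letin E s, F => .letin (E.comp F) s
  | .roll A E, F => .roll A (E.comp F)
  | .unroll E, F => .unroll (E.comp F)
  | .pairL E s, F => .pairL (E.comp F) s
  | .pairR v hv E, F => .pairR v hv (E.comp F)
  | .letpair E s, F => .letpair (E.comp F) s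
  | .inl E, F => .inl (E.comp F)
  | .inr E, F => .inr (E.comp F)
  | .case E s s', F => .case (E.comp F) s s'
  | .appL E s, F => .appL (E.comp F) s
  | .appR v hv E, F => .appR v hv (E.comp F)

/-- Basic reductions with their weight: `1` for unrolling a rolled value, `0` otherwise. -/
inductive Red : ℕ → Tm → Tm → Prop
  | letin {v s : Tm} : IsValue v → Red 0 (.letin v s) (s.subst (single v))
  | unroll {A : Ty 0} {v : Tm} : IsValue v → Red 1 (.unroll (.roll A v)) v
  | letpair {v₁ v₂ t : Tm} : IsValue v₁ → IsValue v₂ →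
      Red 0 (.letpair (.pair v₁ v₂) t) (t.subst (double v₁ v₂))
  | beta {A : Ty 0} {t v : Tm} : IsValue v → Red 0 (.app (.lam A t) v) (t.subst (single v))
  | caseInl {v t t' : Tm} : IsValue v → Red 0 (.case (.inl v) t t') (t.subst (single v))
  | caseInr {v t t' : Tm} : IsValue v → Red 0 (.case (.inr v) t t') (t'.subst (single v))

/-- Small steps with their weight. -/
inductive Step : ℕ → Tm → Tm → Prop
  | err (E : ECtx) : Step 0 (E.plug .err) .err
  | red (E : ECtx) {i : ℕ} {t t' : Tm} : Red i t t' → Step i (E.plug t) (E.plug t')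

/-- The reflexive transitive closure of the small steps, adding up the weights. -/
inductive Steps : ℕ → Tm → Tm → Prop
  | refl (t : Tm) : Steps 0 t t
  | step {i j : ℕ} {t t' t'' : Tm} : Step i t t' → Steps j t' t'' → Steps (i + j) t t''

/-- `t` reduces to `t'`, with any total weight. -/
def Reduces (t t' : Tm) : Prop := ∃ i, Steps i t t'

/-! ## Translation of the cast calculus -/

/-- The translation of `?`: `μα. 1 + ((α × α) + ((α + α) + (α → α)))`. -/
def dynTy : Ty 0 :=
  .mu (.sum .unit (.sum (.prod (.var 0) (.var 0)) (.sum (.sum (.var 0) (.var 0))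
    (.arr (.var 0) (.var 0)))))

/-- Type translation. -/
def GTy.tr : GTy → Ty 0
  | .dyn => dynTy
  | .unit => .unit
  | .prod A B => .prod A.tr B.tr
  | .sum A B => .sum A.tr B.tr
  | .arr A B => .arr A.tr B.tr

/-- Action of `×` on contexts: `let (x, x') = [·] in (E[x], E'[x'])`. All contexts to which the
three actions are applied below have no free variables. -/
def prodCtx (E E' : ECtx) : ECtx :=
  .letpair .hole (.pair (E.plug (.var 1)) (E'.plug (.var 0)))

/-- Action of `+` on contexts: `case [·] of inj x. inj E[x] | inj' x'. inj' E'[x']`. -/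
def sumCtx (E E' : ECtx) : ECtx :=
  .case .hole (.inl (E.plug (.var 0))) (.inr (E'.plug (.var 0)))

/-- Action of `→` on contexts: `let f = [·] in λ (a : A). E'[f (E[a])]`. -/
def arrCtx (A : Ty 0) (E E' : ECtx) : ECtx :=
  .letin .hole (.lam A (E'.plug (.app (.var 1) (E.plug (.var 0)))))

/-- Tagging `roll (sum_G [·])`. -/
def tagCtx : Tag → ECtx
  | .unit => .roll dynTy (.inl .hole)
  | .prod => .roll dynTy (.inr (.inl .hole))
  | .sum => .roll dynTy (.inr (.inr (.inl .hole)))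
  | .arr => .roll dynTy (.inr (.inr (.inr .hole)))

/-- Untagging `case (unroll [·]) of sum_G x. x | else ℧`. -/
def untagCtx (G : Tag) : ECtx :=
  let branch : Tag → Tm := fun G' => if G' = G then .var 0 else .err
  .case (.unroll .hole) (branch .unit)
    (.case (.var 0) (branch .prod)
      (.case (.var 0) (branch .sum) (branch .arr)))

/-- Height of a type, used only for the termination of `castCtx`. -/
def GTy.height : GTy → ℕ
  | .dyn => 0
  | .unit => 0
  | .prod A B => max A.height B.height + 1
  | .sum A B => max A.height B.height + 1
  | .arr A B => max A.height B.height + 1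

/-- The evaluation context that implements the cast from `A` to `B`. -/
def castCtx : GTy → GTy → ECtx
  | .dyn, .dyn => .hole
  | .unit, .unit => .hole
  | .prod A₁ B₁, .prod A₂ B₂ => prodCtx (castCtx A₁ A₂) (castCtx B₁ B₂)
  | .sum A₁ B₁, .sum A₂ B₂ => sumCtx (castCtx A₁ A₂) (castCtx B₁ B₂)
  | .arr A₁ B₁, .arr A₂ B₂ => arrCtx A₂.tr (castCtx A₂ A₁) (castCtx B₁ B₂)
  | .unit, .dyn => tagCtx .unit
  | .prod A B, .dyn =>
      if A = .dyn ∧ B = .dyn then tagCtx .prod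
      else (tagCtx .prod).comp (castCtx (.prod A B) (.prod .dyn .dyn))
  | .sum A B, .dyn =>
      if A = .dyn ∧ B = .dyn then tagCtx .sum
      else (tagCtx .sum).comp (castCtx (.sum A B) (.sum .dyn .dyn))
  | .arr A B, .dyn =>
      if A = .dyn ∧ B = .dyn then tagCtx .arr
      else (tagCtx .arr).comp (castCtx (.arr A B) (.arr .dyn .dyn))
  | .dyn, .unit => untagCtx .unit
  | .dyn, .prod A B =>
      if A = .dyn ∧ B = .dyn then untagCtx .prod
      else (castCtx (.prod .dyn .dyn) (.prod A B)).comp (untagCtx .prod)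
  | .dyn, .sum A B =>
      if A = .dyn ∧ B = .dyn then untagCtx .sum
      else (castCtx (.sum .dyn .dyn) (.sum A B)).comp (untagCtx .sum)
  | .dyn, .arr A B =>
      if A = .dyn ∧ B = .dyn then untagCtx .arr
      else (castCtx (.arr .dyn .dyn) (.arr A B)).comp (untagCtx .arr)
  | _, _ => .letin .hole .err
termination_by A B => 2 * max A.height B.height + (if A = .dyn ∨ B = .dyn then 1 else 0)
decreasing_by
  all_goals simp only [GTy.height, or_false, or_true, if_true, if_false]
  all_goals (try split_ifs) <;> omega

/-- Term translation. -/
def GTm.tr : GTm → Tm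
  | .err => .err
  | .var n => .var n
  | .cast A B t => (castCtx A B).plug t.tr
  | .unit => .unit
  | .pair t s => .pair t.tr s.tr
  | .letpair t s => .letpair t.tr s.tr
  | .inl t => .inl t.tr
  | .inr t => .inr t.tr
  | .case t s s' => .case t.tr s.tr s'.tr
  | .lam A t => .lam A.tr t.tr
  | .app t s => .app t.tr s.tr

/-! ## Embeddings and projections from type dynamism -/

/-- Canonical derivations of type dynamism. -/
inductive Deriv : GTy → GTy → Type
  | idUnit : Deriv .unit .unit
  | idDyn : Deriv .dyn .dyn
  | tag {A : GTy} (G : Tag) : A.tag? = some G → Deriv A G.ty → Deriv A .dyn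
  | prod {A₁ A₂ B₁ B₂ : GTy} : Deriv A₁ A₂ → Deriv B₁ B₂ → Deriv (.prod A₁ B₁) (.prod A₂ B₂)
  | sum {A₁ A₂ B₁ B₂ : GTy} : Deriv A₁ A₂ → Deriv B₁ B₂ → Deriv (.sum A₁ B₁) (.sum A₂ B₂)
  | arr {A₁ A₂ B₁ B₂ : GTy} : Deriv A₁ A₂ → Deriv B₁ B₂ → Deriv (.arr A₁ B₁) (.arr A₂ B₂)

/-- Any two canonical derivations of `A ⊑ B` are equal. -/
theorem Deriv.eq {A B : GTy} (c d : Deriv A B) : c = d := by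
  induction c with
  | idUnit => cases d; rfl
  | idDyn =>
    cases d with
    | idDyn => rfl
    | tag G h _ => simp [GTy.tag?] at h
  | tag G h c ih =>
    cases d with
    | idDyn => simp [GTy.tag?] at h
    | tag G' h' d =>
      obtain rfl : G = G' := Option.some.inj (h.symm.trans h')
      rw [ih d]
  | prod c₁ c₂ ih₁ ih₂ => cases d with | prod d₁ d₂ => rw [ih₁ d₁, ih₂ d₂]
  | sum c₁ c₂ ih₁ ih₂ => cases d with | sum d₁ d₂ => rw [ih₁ d₁, ih₂ d₂]
  | arr c₁ c₂ ih₁ ih₂ => cases d with | arr d₁ d₂ => rw [ih₁ d₁, ih₂ d₂]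

/-- Reflexivity is admissible for canonical derivations. -/
def Deriv.id : (A : GTy) → Deriv A A
  | .dyn => .idDyn
  | .unit => .idUnit
  | .prod A B => .prod (Deriv.id A) (Deriv.id B)
  | .sum A B => .sum (Deriv.id A) (Deriv.id B)
  | .arr A B => .arr (Deriv.id A) (Deriv.id B)

/-- `?` is the greatest type for canonical derivations. -/
def Deriv.top : (A : GTy) → Deriv A .dyn
  | .dyn => .idDyn
  | .unit => .tag .unit rfl .idUnit
  | .prod A B => .tag .prod rfl (.prod (Deriv.top A) (Deriv.top B))
  | .sum A B => .tag .sum rfl (.sum (Deriv.top A) (Deriv.top B))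
  | .arr A B => .tag .arr rfl (.arr (Deriv.top A) (Deriv.top B))

theorem Deriv.tag?_eq {A B : GTy} {G : Tag} (d : Deriv A B) (h : B.tag? = some G) :
    A.tag? = some G := by
  cases d <;> simp_all [GTy.tag?]

/-- Transitivity is admissible for canonical derivations. -/
def Deriv.comp : {A B C : GTy} → Deriv B C → Deriv A B → Deriv A C
  | _, _, _, .idUnit, d => d
  | _, _, _, .idDyn, d => d
  | _, _, _, .tag G h c, d => .tag G (d.tag?_eq h) (c.comp d)
  | _, _, _, .prod c₁ c₂, .prod d₁ d₂ => .prod (c₁.comp d₁) (c₂.comp d₂)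
  | _, _, _, .sum c₁ c₂, .sum d₁ d₂ => .sum (c₁.comp d₁) (c₂.comp d₂)
  | _, _, _, .arr c₁ c₂, .arr d₁ d₂ => .arr (c₁.comp d₁) (c₂.comp d₂)

/-- Type dynamism has canonical derivations. -/
theorem TyDyn.nonempty_deriv {A B : GTy} (h : TyDyn A B) : Nonempty (Deriv A B) := by
  induction h with
  | refl A => exact ⟨Deriv.id A⟩
  | trans _ _ ih₁ ih₂ => exact ih₁.elim fun d => ih₂.elim fun c => ⟨c.comp d⟩
  | top A => exact ⟨Deriv.top A⟩
  | sum _ _ ih₁ ih₂ => exact ih₁.elim fun c => ih₂.elim fun d => ⟨.sum c d⟩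
  | prod _ _ ih₁ ih₂ => exact ih₁.elim fun c => ih₂.elim fun d => ⟨.prod c d⟩
  | arr _ _ ih₁ ih₂ => exact ih₁.elim fun c => ih₂.elim fun d => ⟨.arr c d⟩

/-- The canonical derivation of `A ⊑ B`; it is unique by `Deriv.eq`. -/
noncomputable def TyDyn.deriv {A B : GTy} (h : TyDyn A B) : Deriv A B :=
  Classical.choice h.nonempty_deriv

/-- Embedding or projection. -/
inductive Mode : Type
  | emb | prj

/-- The complementary mode. -/
def Mode.swap : Mode → Mode
  | .emb => .prj
  | .prj => .emb

/-- The embedding (from `A` to `B`) and the projection (from `B` to `A`) that are denoted by a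
canonical derivation of `A ⊑ B`. -/
def Deriv.ctx : {A B : GTy} → Mode → Deriv A B → ECtx
  | _, _, _, .idUnit => .hole
  | _, _, _, .idDyn => .hole
  | _, _, .emb, .tag G _ c => (tagCtx G).comp (c.ctx .emb)
  | _, _, .prj, .tag G _ c => (c.ctx .prj).comp (untagCtx G)
  | _, _, m, .prod c d => prodCtx (c.ctx m) (d.ctx m)
  | _, _, m, .sum c d => sumCtx (c.ctx m) (d.ctx m)
  | _, _, m, @Deriv.arr A₁ A₂ _ _ c d =>
      arrCtx (match m with | .emb => A₂.tr | .prj => A₁.tr) (c.ctx m.swap) (d.ctx m)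

/-- The upcast context from `A` to `B`, for `A ⊑ B`. -/
noncomputable def TyDyn.emb {A B : GTy} (h : TyDyn A B) : ECtx := h.deriv.ctx .emb

theorem EnvDyn.head {Γ₁ Γ₂ : List GTy} {A₁ A₂ : GTy} (h : EnvDyn (A₁ :: Γ₁) (A₂ :: Γ₂)) :
    TyDyn A₁ A₂ := by
  cases h; assumption

theorem EnvDyn.tail {Γ₁ Γ₂ : List GTy} {A₁ A₂ : GTy} (h : EnvDyn (A₁ :: Γ₁) (A₂ :: Γ₂)) :
    EnvDyn Γ₁ Γ₂ := by
  cases h; assumption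

/-- The upcast contexts from the types of `Γ₁` to those of `Γ₂`, in the order of the lists. -/
noncomputable def EnvDyn.embs : {Γ₁ Γ₂ : List GTy} → EnvDyn Γ₁ Γ₂ → List ECtx
  | _ :: _, _ :: _, h => h.head.emb :: h.tail.embs
  | _, _, _ => []

/-- `letEnv n [Eₙ, …, E₁] t` is
`let y₁ = E₁[x₁] in … let yₙ = Eₙ[xₙ] in t`,
where `x₁, …, xₙ` are the `n` free variables (with `xₙ` the most recent one) and `t` only refers
to `y₁, …, yₙ`. At the `i`-th `let`, the variable `xᵢ` has index `(n - i) + (i - 1) = n - 1`. -/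
def letEnv (n : ℕ) : List ECtx → Tm → Tm
  | [], t => t
  | E :: Es, t => letEnv n Es (.letin (E.plug (.var (n - 1))) t)

/-! ## The error approximation logical relation -/

/-- The two halves of the relation: `prec` counts the unrollings of the left term (approximation
up to divergence on the left), `succ` those of the right term. -/
inductive Side : Type
  | prec | succ

/-- Closed values of type `A`. -/
def ClosedVal (A : Ty 0) (v : Tm) : Prop := IsValue v ∧ HasTy [] v A

/-- The relation on closed terms of type `A` at index `i`, where `V j` is the relation on closed
values of type `A` at index `i - j`. -/
def TermRelWith (A : Ty 0) (V : ℕ → Tm → Tm → Prop) : Side → ℕ → Tm → Tm → Prop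
  | .prec, i, t₁, t₂ => HasTy [] t₁ A ∧ HasTy [] t₂ A ∧
      ((∃ t₁', Steps (i + 1) t₁ t₁') ∨
       (∃ j ≤ i, Steps j t₁ .err) ∨
       (∃ j ≤ i, ∃ v₁ v₂, V j v₁ v₂ ∧ Steps j t₁ v₁ ∧ Reduces t₂ v₂))
  | .succ, i, t₁, t₂ => HasTy [] t₁ A ∧ HasTy [] t₂ A ∧
      ((∃ t₂', Steps (i + 1) t₂ t₂') ∨
       (∃ j ≤ i, Steps j t₂ .err ∧ Reduces t₁ .err) ∨
       (∃ j ≤ i, ∃ v₂, ClosedVal A v₂ ∧ Steps j t₂ v₂ ∧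
         (Reduces t₁ .err ∨ ∃ v₁, Reduces t₁ v₁ ∧ V j v₁ v₂)))

/-- The relation on closed values of type `A` at index `i`. -/
def ValRel (side : Side) (i : ℕ) (A : Ty 0) (v₁ v₂ : Tm) : Prop :=
  ClosedVal A v₁ ∧ ClosedVal A v₂ ∧
  match i, A with
  | 0, .mu _ => True
  | i + 1, .mu A => ∃ w₁ w₂, v₁ = .roll (.mu A) w₁ ∧ v₂ = .roll (.mu A) w₂ ∧
      ValRel side i A.unfold w₁ w₂
  | _, .unit => v₁ = .unit ∧ v₂ = .unit
  | i, .prod A A' => ∃ w₁ w₁' w₂ w₂', v₁ = .pair w₁ w₁' ∧ v₂ = .pair w₂ w₂' ∧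
      ValRel side i A w₁ w₂ ∧ ValRel side i A' w₁' w₂'
  | i, .sum A B =>
      (∃ w₁ w₂, ValRel side i A w₁ w₂ ∧ v₁ = .inl w₁ ∧ v₂ = .inl w₂) ∨
      (∃ w₁ w₂, ValRel side i B w₁ w₂ ∧ v₁ = .inr w₁ ∧ v₂ = .inr w₂)
  | i, .arr A B => ∀ j, (_ : j ≤ i) → ∀ w₁ w₂, ValRel side j A w₁ w₂ →
      TermRelWith B (fun k u₁ u₂ => ValRel side (j - k) B u₁ u₂) side j
        (.app v₁ w₁) (.app v₂ w₂)
termination_by (i, sizeOf A)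
decreasing_by
  all_goals simp [Prod.lex_def] <;> omega

/-- The relation on closed terms of type `A` at index `i`. -/
def TermRel (side : Side) (i : ℕ) (A : Ty 0) (t₁ t₂ : Tm) : Prop :=
  TermRelWith A (fun j v₁ v₂ => ValRel side (i - j) A v₁ v₂) side i t₁ t₂

/-- Related closing substitutions for `Γ`. Only the values at the variables of `Γ` matter. -/
def SubstRel (side : Side) (i : ℕ) (Γ : List (Ty 0)) (γ₁ γ₂ : ℕ → Tm) : Prop :=
  ∀ n A, Γ[n]? = some A → ValRel side i A (γ₁ n) (γ₂ n)

/-- Logical error approximation `Γ ⊨ t₁ ⊑ t₂ : A` of open terms: both halves of the relation, at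
every index. -/
def LogApprox (Γ : List (Ty 0)) (t₁ t₂ : Tm) (A : Ty 0) : Prop :=
  HasTy Γ t₁ A ∧ HasTy Γ t₂ A ∧
  ∀ (side : Side) (i : ℕ) (γ₁ γ₂ : ℕ → Tm), SubstRel side i Γ γ₁ γ₂ →
    TermRel side i A (t₁.subst γ₁) (t₂.subst γ₂)

/-- Logical term dynamism `Γ₁ ⊑ Γ₂ ⊨ t₁ ⊑ t₂ : A₁ ⊑ A₂`: the upcast of `t₁` approximates `t₂` run
on upcast inputs. -/
def LogTermDyn (Γ₁ Γ₂ : List GTy) (t₁ t₂ : Tm) (A₁ A₂ : GTy) : Prop :=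
  HasTy (Γ₁.map GTy.tr) t₁ A₁.tr ∧ HasTy (Γ₂.map GTy.tr) t₂ A₂.tr ∧
  ∃ (hΓ : EnvDyn Γ₁ Γ₂) (hA : TyDyn A₁ A₂),
    LogApprox (Γ₁.map GTy.tr) (hA.emb.plug t₁) (letEnv Γ₁.length hΓ.embs t₂) A₂.tr

end Graduality

/-! Upcasts on one side do not pass well through an induction on term dynamism, so they are replaced
by a heterogeneous relation. A canonical derivation of `A ⊑ B` denotes a step-indexed relation
`Deriv.sem` between values of `A` and values of `B`: type constructors act as usual in a logical
relation, and a value is related to a value of `?` when the latter is a tagged value whose content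
it is related to. For a reflexive derivation this is the logical relation itself (`Deriv.sem_id`).

The heart is `castRel`: if `A₁ ⊑ A₂` and `B₁ ⊑ B₂`, then the casts `A₁ ⇒ B₁` and `A₂ ⇒ B₂` send
related values to related terms. A type other than `?` has the same tag as every type below it. So
when neither `A₂` nor `B₂` is `?`, the two casts both act componentwise or both fail; when `?`
occurs, either the left cast fails, which puts it below everything, or some tagging and untagging
happens that the relation absorbs. The induction is on the sum of the heights of the two
derivations, since function casts exchange their roles.

With `castRel` for the cast rule, `TermDyn.sound` is an ordinary fundamental lemma. The required
form follows from two degenerate instances of `castRel` in which one side does nothing: from `A₁ ⊑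
A₁` to `A₁ ⊑ A₂` for the inputs upcast on the right, and from `A₁ ⊑ A₂` to `A₂ ⊑ A₂` for the result
upcast on the left.

Each half of the relation counts the unrollings of one side only, so the content of a value of `?`
has a smaller index only on `succ`. On that half a failing left term is related to a right term only
if the latter exceeds the bound, fails or returns. This form of type safety comes from reflexivity
of the other half, `HasTy.tm_prec`. -/

namespace Graduality

/-! ## Substitution -/

theorem upRen_comp (ρ ρ' : ℕ → ℕ) : upRen ρ' ∘ upRen ρ = upRen (ρ' ∘ ρ) := by
  funext n; cases n <;> rfl

theorem Tm.rename_rename (t : Tm) : ∀ (ρ ρ' : ℕ → ℕ),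
    (t.rename ρ).rename ρ' = t.rename (ρ' ∘ ρ) := by
  induction t <;> intro ρ ρ' <;> simp_all [Tm.rename, upRen_comp]

theorem up_comp_upRen (ρ : ℕ → ℕ) (σ : ℕ → Tm) : up σ ∘ upRen ρ = up (σ ∘ ρ) := by
  funext n; cases n <;> rfl

theorem Tm.rename_subst (t : Tm) : ∀ (ρ : ℕ → ℕ) (σ : ℕ → Tm),
    (t.rename ρ).subst σ = t.subst (σ ∘ ρ) := by
  induction t <;> intro ρ σ <;> simp_all [Tm.rename, Tm.subst, up_comp_upRen]

theorem up_rename (ρ : ℕ → ℕ) (σ : ℕ → Tm) :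
    (fun n => (up σ n).rename (upRen ρ)) = up fun n => (σ n).rename ρ := by
  funext n
  cases n with
  | zero => rfl
  | succ n => simp only [up, Tm.rename_rename]; rfl

theorem Tm.subst_rename (t : Tm) : ∀ (σ : ℕ → Tm) (ρ : ℕ → ℕ),
    (t.subst σ).rename ρ = t.subst fun n => (σ n).rename ρ := by
  induction t <;> intro σ ρ <;> simp_all [Tm.rename, Tm.subst, up_rename]

theorem up_subst (σ τ : ℕ → Tm) :
    (fun n => (up σ n).subst (up τ)) = up fun n => (σ n).subst τ := by
  funext n
  cases n with
  | zero => rfl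
  | succ n => simp only [up, Tm.rename_subst, Tm.subst_rename]; rfl

theorem Tm.subst_subst (t : Tm) : ∀ σ τ : ℕ → Tm,
    (t.subst σ).subst τ = t.subst fun n => (σ n).subst τ := by
  induction t <;> intro σ τ <;> simp_all [Tm.subst, up_subst]

theorem up_var : up Tm.var = Tm.var := by
  funext n; cases n <;> rfl

theorem Tm.subst_var (t : Tm) : t.subst .var = t := by
  induction t <;> simp_all [Tm.subst, up_var]

theorem Tm.rename_succ_subst_single (t v : Tm) : (t.rename Nat.succ).subst (single v) = t := by
  rw [Tm.rename_subst]
  exact t.subst_var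

/-- Extension of a substitution by a term for the most recent variable. -/
def scons (v : Tm) (σ : ℕ → Tm) : ℕ → Tm
  | 0 => v
  | n + 1 => σ n

theorem Tm.subst_up_single (t v : Tm) (σ : ℕ → Tm) :
    (t.subst (up σ)).subst (single v) = t.subst (scons v σ) := by
  rw [Tm.subst_subst]
  congr 1
  funext n
  cases n with
  | zero => rfl
  | succ n => exact (σ n).rename_succ_subst_single v

theorem Tm.subst_up_up_double (t v w : Tm) (σ : ℕ → Tm) :
    (t.subst (up (up σ))).subst (double v w) = t.subst (scons w (scons v σ)) := by
  rw [Tm.subst_subst]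
  congr 1
  funext n
  match n with
  | 0 => rfl
  | 1 => rfl
  | n + 2 =>
    simp only [up, scons, Tm.rename_rename, Tm.rename_subst]
    exact (σ n).subst_var

/-! ## Typing of substitution instances -/

theorem HasTy.rename {Γ : List (Ty 0)} {t : Tm} {A : Ty 0} (h : HasTy Γ t A) :
    ∀ {Δ : List (Ty 0)} {ρ : ℕ → ℕ}, (∀ n B, Γ[n]? = some B → Δ[ρ n]? = some B) →
      HasTy Δ (t.rename ρ) A := by
  have key : ∀ {Γ Δ : List (Ty 0)} {ρ : ℕ → ℕ} (C : Ty 0),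
      (∀ n B, Γ[n]? = some B → Δ[ρ n]? = some B) →
      ∀ n B, (C :: Γ)[n]? = some B → (C :: Δ)[upRen ρ n]? = some B := by
    intro Γ Δ ρ C h n B hn
    cases n with
    | zero => exact hn
    | succ n => exact h n B hn
  induction h with
  | err => intros; exact .err
  | var h => intro Δ ρ hρ; exact .var (hρ _ _ h)
  | letin _ _ ih₁ ih₂ => intro Δ ρ hρ; exact .letin (ih₁ hρ) (ih₂ (key _ hρ))
  | roll _ ih => intro Δ ρ hρ; exact .roll (ih hρ)
  | unroll _ ih => intro Δ ρ hρ; exact .unroll (ih hρ)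
  | unit => intros; exact .unit
  | pair _ _ ih₁ ih₂ => intro Δ ρ hρ; exact .pair (ih₁ hρ) (ih₂ hρ)
  | letpair _ _ ih₁ ih₂ => intro Δ ρ hρ; exact .letpair (ih₁ hρ) (ih₂ (key _ (key _ hρ)))
  | inl _ ih => intro Δ ρ hρ; exact .inl (ih hρ)
  | inr _ ih => intro Δ ρ hρ; exact .inr (ih hρ)
  | case _ _ _ ih₁ ih₂ ih₃ =>
    intro Δ ρ hρ; exact .case (ih₁ hρ) (ih₂ (key _ hρ)) (ih₃ (key _ hρ))
  | lam _ ih => intro Δ ρ hρ; exact .lam (ih (key _ hρ))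
  | app _ _ ih₁ ih₂ => intro Δ ρ hρ; exact .app (ih₁ hρ) (ih₂ hρ)

theorem HasTy.subst {Γ : List (Ty 0)} {t : Tm} {A : Ty 0} (h : HasTy Γ t A) :
    ∀ {Δ : List (Ty 0)} {σ : ℕ → Tm}, (∀ n B, Γ[n]? = some B → HasTy Δ (σ n) B) →
      HasTy Δ (t.subst σ) A := by
  have key : ∀ {Γ Δ : List (Ty 0)} {σ : ℕ → Tm} (C : Ty 0),
      (∀ n B, Γ[n]? = some B → HasTy Δ (σ n) B) →
      ∀ n B, (C :: Γ)[n]? = some B → HasTy (C :: Δ) (up σ n) B := by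
    intro Γ Δ σ C h n B hn
    cases n with
    | zero => exact .var hn
    | succ n => exact (h n B hn).rename fun _ _ h => h
  induction h with
  | err => intros; exact .err
  | var h => intro Δ ρ hρ; exact hρ _ _ h
  | letin _ _ ih₁ ih₂ => intro Δ ρ hρ; exact .letin (ih₁ hρ) (ih₂ (key _ hρ))
  | roll _ ih => intro Δ ρ hρ; exact .roll (ih hρ)
  | unroll _ ih => intro Δ ρ hρ; exact .unroll (ih hρ)
  | unit => intros; exact .unit
  | pair _ _ ih₁ ih₂ => intro Δ ρ hρ; exact .pair (ih₁ hρ) (ih₂ hρ)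
  | letpair _ _ ih₁ ih₂ => intro Δ ρ hρ; exact .letpair (ih₁ hρ) (ih₂ (key _ (key _ hρ)))
  | inl _ ih => intro Δ ρ hρ; exact .inl (ih hρ)
  | inr _ ih => intro Δ ρ hρ; exact .inr (ih hρ)
  | case _ _ _ ih₁ ih₂ ih₃ =>
    intro Δ ρ hρ; exact .case (ih₁ hρ) (ih₂ (key _ hρ)) (ih₃ (key _ hρ))
  | lam _ ih => intro Δ ρ hρ; exact .lam (ih (key _ hρ))
  | app _ _ ih₁ ih₂ => intro Δ ρ hρ; exact .app (ih₁ hρ) (ih₂ hρ)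

/-! ## Reduction -/

theorem ECtx.plug_comp (E F : ECtx) (t : Tm) : (E.comp F).plug t = E.plug (F.plug t) := by
  induction E <;> simp_all [ECtx.comp, ECtx.plug]

theorem ECtx.isValue_of_plug {E : ECtx} {t : Tm} (h : IsValue (E.plug t)) : IsValue t := by
  induction E with
  | hole => exact h
  | letin | unroll | letpair | case | appL | appR => cases h
  | roll A E ih | inl E ih | inr E ih => cases h; exact ih ‹_›
  | pairL E s ih => cases h; exact ih ‹_›
  | pairR v hv E ih => cases h; exact ih ‹_›

theorem IsValue.not_step {i : ℕ} {v t : Tm} (hv : IsValue v) : ¬ Step i v t := by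
  rintro (E | ⟨E, r⟩)
  · cases ECtx.isValue_of_plug hv
  · have := ECtx.isValue_of_plug hv
    cases r <;> cases this

theorem IsValue.steps {i : ℕ} {v t : Tm} (hv : IsValue v) (h : Steps i v t) :
    i = 0 ∧ t = v := by
  cases h with
  | refl => exact ⟨rfl, rfl⟩
  | step s _ => exact (hv.not_step s).elim

theorem Red.steps {i : ℕ} {t t' : Tm} (h : Red i t t') : Steps i t t' :=
  .step (.red .hole h) (.refl _)

theorem Steps.trans {i j : ℕ} {t t' t'' : Tm} (h : Steps i t t') (h' : Steps j t' t'') :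
    Steps (i + j) t t'' := by
  induction h with
  | refl => rwa [Nat.zero_add]
  | step s _ ih => rw [Nat.add_assoc]; exact .step s (ih h')

theorem Steps.trans_zero {i : ℕ} {t t' t'' : Tm} (h : Steps i t t') (h' : Steps 0 t' t'') :
    Steps i t t'' := h.trans h'

theorem Steps.reduces {i : ℕ} {t t' : Tm} (h : Steps i t t') : Reduces t t' := ⟨i, h⟩

theorem Reduces.refl (t : Tm) : Reduces t t := ⟨0, .refl t⟩

theorem Reduces.trans {t t' t'' : Tm} (h : Reduces t t') (h' : Reduces t' t'') :
    Reduces t t'' := by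
  obtain ⟨i, h⟩ := h
  obtain ⟨j, h'⟩ := h'
  exact ⟨_, h.trans h'⟩

theorem ECtx.steps_err (E : ECtx) : Steps 0 (E.plug .err) .err := .step (.err E) (.refl _)

/-- With the empty context the error rule lets `℧` step to itself, so `℧` is not irreducible; but
such steps have weight 0 and lead nowhere else. -/
theorem Steps.of_err {i : ℕ} {t : Tm} (h : Steps i .err t) : i = 0 ∧ t = .err := by
  generalize hs : Tm.err = s at h
  induction h with
  | refl => exact ⟨rfl, rfl⟩
  | step s _ ih =>
    rw [← hs]
    cases s with
    | err => simpa using ih rfl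
    | red E r =>
      cases E <;> simp only [ECtx.plug] at hs <;> try cases hs
      cases r

/-- Steps inside an evaluation context, unless the context is discarded by an error. -/
theorem Steps.plug_or {i : ℕ} {t t' : Tm} (E : ECtx) (h : Steps i t t') :
    Steps i (E.plug t) (E.plug t') ∨ (t' = .err ∧ Steps i (E.plug t) .err) := by
  induction h with
  | refl => exact .inl (.refl _)
  | step s h ih =>
    cases s with
    -- The error discards all of `E[F]` at once and so ends in `℧`, not in `E[℧]`.
    | err F =>
      obtain ⟨rfl, rfl⟩ := h.of_err
      rw [← ECtx.plug_comp]
      exact .inr ⟨rfl, (E.comp F).steps_err⟩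
    | red F r =>
      have s := Step.red (E.comp F) r
      rw [ECtx.plug_comp, ECtx.plug_comp] at s
      exact ih.imp (.step s) fun ⟨h₁, h₂⟩ => ⟨h₁, .step s h₂⟩

theorem Steps.plug_exists {i : ℕ} {t t' : Tm} (E : ECtx) (h : Steps i t t') :
    ∃ t'', Steps i (E.plug t) t'' :=
  (h.plug_or E).elim (fun h => ⟨_, h⟩) fun h => ⟨_, h.2⟩

theorem Steps.plug_err {i : ℕ} {t : Tm} (E : ECtx) (h : Steps i t .err) :
    Steps i (E.plug t) .err :=
  (h.plug_or E).elim (fun h => h.trans_zero E.steps_err) fun h => h.2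

theorem Steps.plug {i : ℕ} {t v : Tm} (E : ECtx) (hv : v ≠ .err) (h : Steps i t v) :
    Steps i (E.plug t) (E.plug v) :=
  (h.plug_or E).resolve_right fun h => hv h.1

theorem IsValue.ne_err {v : Tm} (h : IsValue v) : v ≠ .err := by
  rintro rfl; cases h

theorem Reduces.plug_err {t : Tm} (E : ECtx) (h : Reduces t .err) : Reduces (E.plug t) .err := by
  obtain ⟨i, h⟩ := h
  exact ⟨i, h.plug_err E⟩

theorem Reduces.plug {t v : Tm} (E : ECtx) (hv : IsValue v) (h : Reduces t v) :
    Reduces (E.plug t) (E.plug v) := by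
  obtain ⟨i, h⟩ := h
  exact ⟨i, h.plug E hv.ne_err⟩

/-! ## Canonical forms -/

theorem ClosedVal.prod_inv {A B : Ty 0} {v : Tm} (h : ClosedVal (.prod A B) v) :
    ∃ a b, v = .pair a b ∧ ClosedVal A a ∧ ClosedVal B b := by
  obtain ⟨hv, ht⟩ := h
  cases hv <;> cases ht
  · simp_all
  · exact ⟨_, _, rfl, ⟨‹_›, ‹_›⟩, ⟨‹_›, ‹_›⟩⟩

theorem ClosedVal.sum_inv {A B : Ty 0} {v : Tm} (h : ClosedVal (.sum A B) v) :
    (∃ a, v = .inl a ∧ ClosedVal A a) ∨ ∃ b, v = .inr b ∧ ClosedVal B b := by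
  obtain ⟨hv, ht⟩ := h
  cases hv <;> cases ht
  · simp_all
  · exact .inl ⟨_, rfl, ‹_›, ‹_›⟩
  · exact .inr ⟨_, rfl, ‹_›, ‹_›⟩

theorem ClosedVal.mu_inv {A : Ty 1} {v : Tm} (h : ClosedVal (.mu A) v) :
    ∃ w, v = .roll (.mu A) w ∧ ClosedVal A.unfold w := by
  obtain ⟨hv, ht⟩ := h
  cases hv <;> cases ht
  · simp_all
  · exact ⟨_, rfl, ‹_›, ‹_›⟩

theorem ClosedVal.pair {A B : Ty 0} {a b : Tm} (ha : ClosedVal A a) (hb : ClosedVal B b) :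
    ClosedVal (.prod A B) (.pair a b) := ⟨.pair ha.1 hb.1, .pair ha.2 hb.2⟩

theorem ClosedVal.inl {A B : Ty 0} {a : Tm} (ha : ClosedVal A a) :
    ClosedVal (.sum A B) (.inl a) := ⟨.inl ha.1, .inl ha.2⟩

theorem ClosedVal.inr {A B : Ty 0} {b : Tm} (hb : ClosedVal B b) :
    ClosedVal (.sum A B) (.inr b) := ⟨.inr hb.1, .inr hb.2⟩

theorem ClosedVal.roll {A : Ty 1} {w : Tm} (hw : ClosedVal A.unfold w) :
    ClosedVal (.mu A) (.roll (.mu A) w) := ⟨.roll _ hw.1, .roll hw.2⟩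

theorem ClosedVal.lam {A B : Ty 0} {t : Tm} (h : HasTy [A] t B) :
    ClosedVal (.arr A B) (.lam A t) := ⟨.lam _ _, .lam h⟩

/-! ## Semantic types -/

/-- A family of step-indexed relations between the closed values of two types. -/
structure SemTy (side : Side) (A₁ A₂ : Ty 0) where
  /-- The relation on values at an index. -/
  rel : ℕ → Tm → Tm → Prop
  closed_left : ∀ {i v₁ v₂}, rel i v₁ v₂ → ClosedVal A₁ v₁
  closed_right : ∀ {i v₁ v₂}, rel i v₁ v₂ → ClosedVal A₂ v₂
  mono : ∀ {i j v₁ v₂}, j ≤ i → rel i v₁ v₂ → rel j v₁ v₂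

/-- The extension of a semantic type to terms. -/
def SemTy.tm : {side : Side} → {A₁ A₂ : Ty 0} → SemTy side A₁ A₂ → ℕ → Tm → Tm → Prop
  | .prec, _, _, R, i, t₁, t₂ =>
      (∃ t₁', Steps (i + 1) t₁ t₁') ∨
      (∃ j ≤ i, Steps j t₁ .err) ∨
      (∃ j ≤ i, ∃ v₁ v₂, R.rel (i - j) v₁ v₂ ∧ Steps j t₁ v₁ ∧ Reduces t₂ v₂)
  | .succ, _, A₂, R, i, t₁, t₂ =>
      (∃ t₂', Steps (i + 1) t₂ t₂') ∨
      (∃ j ≤ i, Steps j t₂ .err ∧ Reduces t₁ .err) ∨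
      (∃ j ≤ i, ∃ v₂, ClosedVal A₂ v₂ ∧ Steps j t₂ v₂ ∧
        (Reduces t₁ .err ∨ ∃ v₁, Reduces t₁ v₁ ∧ R.rel (i - j) v₁ v₂))

/-- For every bound on the weight, `t` exceeds the bound, fails, or returns a value. -/
def Outcome (A : Ty 0) (t : Tm) : Prop :=
  ∀ i, (∃ t', Steps (i + 1) t t') ∨ (∃ j ≤ i, Steps j t .err) ∨
    ∃ j ≤ i, ∃ v, ClosedVal A v ∧ Steps j t v

/-- On the side `succ`, all closed well-typed terms have an outcome. -/
class HasOutcomes (side : Side) : Prop where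
  outcome : side = .succ → ∀ {A : Ty 0} {t : Tm}, HasTy [] t A → Outcome A t

/-- Vacuous, since the condition concerns `succ` only. The congruence lemmas are thereby usable on
`prec` to prove that well-typed terms have outcomes, which then gives the instance for both sides.
-/
instance : HasOutcomes .prec := ⟨nofun⟩

/-! ### The term relation under reduction and in evaluation contexts. -/

namespace SemTy

variable {side : Side} {A₁ A₂ B₁ B₂ C₁ C₂ : Ty 0} {i : ℕ} {t₁ t₂ s₁ s₂ : Tm}

theorem tm_of_rel {R : SemTy side A₁ A₂} (h : R.rel i t₁ t₂) : R.tm i t₁ t₂ := by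
  cases side with
  | prec => exact .inr (.inr ⟨0, i.zero_le, _, _, h, .refl _, .refl _⟩)
  | succ =>
    exact .inr (.inr ⟨0, i.zero_le, _, R.closed_right h, .refl _, .inr ⟨_, .refl _, h⟩⟩)

/-- The steps of the side that is counted, and some steps of the other one. -/
def _root_.Graduality.Side.Steps (j : ℕ) (t₁ t₁' t₂ t₂' : Tm) : Side → Prop
  | .prec => Graduality.Steps j t₁ t₁' ∧ Reduces t₂ t₂'
  | .succ => Graduality.Steps j t₂ t₂' ∧ Reduces t₁ t₁'

/-- Closure under expansion: weight on the counted side is added to the index, and steps on the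
other side are free. -/
theorem tm_of_steps {R : SemTy side A₁ A₂} {j : ℕ} (h : side.Steps j t₁ s₁ t₂ s₂)
    (hr : R.tm i s₁ s₂) : R.tm (i + j) t₁ t₂ := by
  cases side with
  | prec =>
    obtain ⟨h₁, h₂⟩ := h
    rcases hr with ⟨t, h⟩ | ⟨k, hk, h⟩ | ⟨k, hk, v₁, v₂, hv, h, h'⟩
    · exact .inl ⟨t, by convert h₁.trans h using 1; omega⟩
    · exact .inr (.inl ⟨_, by omega, h₁.trans h⟩)
    · exact .inr (.inr ⟨j + k, by omega, v₁, v₂, by convert hv using 1; omega, h₁.trans h,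
        h₂.trans h'⟩)
  | succ =>
    obtain ⟨h₂, h₁⟩ := h
    rcases hr with ⟨t, h⟩ | ⟨k, hk, h, h'⟩ | ⟨k, hk, v₂, hv, h, h'⟩
    · exact .inl ⟨t, by convert h₂.trans h using 1; omega⟩
    · exact .inr (.inl ⟨_, by omega, h₂.trans h, h₁.trans h'⟩)
    · refine .inr (.inr ⟨j + k, by omega, v₂, hv, h₂.trans h, h'.imp h₁.trans ?_⟩)
      rintro ⟨v₁, h, hv⟩
      exact ⟨v₁, h₁.trans h, by convert hv using 1; omega⟩

theorem tm_of_steps_zero {R : SemTy side A₁ A₂} (h₁ : Steps 0 t₁ s₁) (h₂ : Steps 0 t₂ s₂)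
    (hr : R.tm i s₁ s₂) : R.tm i t₁ t₂ := by
  refine tm_of_steps (j := 0) ?_ hr
  cases side
  · exact ⟨h₁, h₂.reduces⟩
  · exact ⟨h₂, h₁.reduces⟩

/-- At index 0 a counted step of weight 1 already exceeds the bound, so the results need only be
related at the predecessor of a positive index. -/
theorem tm_of_steps_one {R : SemTy side A₁ A₂} (h₁ : Steps 1 t₁ s₁) (h₂ : Steps 1 t₂ s₂)
    (hr : ∀ k, i = k + 1 → R.tm k s₁ s₂) : R.tm i t₁ t₂ := by
  cases i with
  | zero =>
    cases side
    · exact .inl ⟨_, h₁⟩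
    · exact .inl ⟨_, h₂⟩
  | succ k =>
    refine tm_of_steps (j := 1) ?_ (hr k rfl)
    cases side
    · exact ⟨h₁, h₂.reduces⟩
    · exact ⟨h₂, h₁.reduces⟩

theorem tm_err (R : SemTy side A₁ A₂) : R.tm i .err .err := by
  cases side with
  | prec => exact .inr (.inl ⟨0, i.zero_le, .refl _⟩)
  | succ => exact .inr (.inl ⟨0, i.zero_le, .refl _, .refl _⟩)

/-- Failure on the left approximates everything. On `prec` this is a clause of the definition. On
`succ` the clauses are driven by the right term, whose possible outcomes are known from its typing.
-/
theorem tm_of_left_err [HasOutcomes side] (R : SemTy side A₁ A₂) {j : ℕ} (hj : j ≤ i)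
    (h₁ : Steps j t₁ .err) (h₂ : HasTy [] t₂ A₂) : R.tm i t₁ t₂ := by
  cases side with
  | prec => exact .inr (.inl ⟨j, hj, h₁⟩)
  | succ =>
    rcases HasOutcomes.outcome rfl h₂ i with h | ⟨k, hk, h⟩ | ⟨k, hk, v, hv, h⟩
    · exact .inl h
    · exact .inr (.inl ⟨k, hk, h, h₁.reduces⟩)
    · exact .inr (.inr ⟨k, hk, v, hv, h, .inl h₁.reduces⟩)

/-- Related terms may be put into evaluation contexts that map related values to related terms. -/
theorem tm_bind [HasOutcomes side] {R : SemTy side A₁ A₂} {S : SemTy side B₁ B₂} (E₁ E₂ : ECtx)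
    (ht : R.tm i t₁ t₂) (hE : HasTy [] (E₂.plug t₂) B₂)
    (h : ∀ j ≤ i, ∀ v₁ v₂, R.rel j v₁ v₂ → S.tm j (E₁.plug v₁) (E₂.plug v₂)) :
    S.tm i (E₁.plug t₁) (E₂.plug t₂) := by
  cases side with
  | prec =>
    rcases ht with ⟨t, h₁⟩ | ⟨k, hk, h₁⟩ | ⟨k, hk, v₁, v₂, hv, h₁, h₂⟩
    · exact .inl (h₁.plug_exists E₁)
    · exact .inr (.inl ⟨k, hk, h₁.plug_err E₁⟩)
    · have := tm_of_steps (side := .prec) (j := k)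
        ⟨h₁.plug E₁ (R.closed_left hv).1.ne_err, h₂.plug E₂ (R.closed_right hv).1⟩
        (h (i - k) (by omega) v₁ v₂ hv)
      rwa [Nat.sub_add_cancel hk] at this
  | succ =>
    rcases ht with ⟨t, h₂⟩ | ⟨k, hk, h₂, h₁⟩ | ⟨k, hk, v₂, hv, h₂, h₁ | ⟨v₁, h₁, hv⟩⟩
    · exact .inl (h₂.plug_exists E₂)
    · exact .inr (.inl ⟨k, hk, h₂.plug_err E₂, h₁.plug_err E₁⟩)
    -- The left term fails while the right one returns a value, so `h` does not apply; the outcome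
    -- of the whole right term decides instead.
    · rcases HasOutcomes.outcome rfl hE i with h | ⟨k, hk, h⟩ | ⟨k, hk, v, hv, h⟩
      · exact .inl h
      · exact .inr (.inl ⟨k, hk, h, h₁.plug_err E₁⟩)
      · exact .inr (.inr ⟨k, hk, v, hv, h, .inl (h₁.plug_err E₁)⟩)
    · have := tm_of_steps (side := .succ) (j := k)
        ⟨h₂.plug E₂ (R.closed_right hv).1.ne_err, h₁.plug E₁ (R.closed_left hv).1⟩
        (h (i - k) (by omega) v₁ v₂ hv)
      rwa [Nat.sub_add_cancel hk] at this

/-- Products of semantic types. -/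
def prod (R : SemTy side A₁ A₂) (S : SemTy side B₁ B₂) :
    SemTy side (.prod A₁ B₁) (.prod A₂ B₂) where
  rel i v₁ v₂ := ∃ a₁ b₁ a₂ b₂, v₁ = .pair a₁ b₁ ∧ v₂ = .pair a₂ b₂ ∧
    R.rel i a₁ a₂ ∧ S.rel i b₁ b₂
  closed_left := by
    rintro _ _ _ ⟨a₁, b₁, a₂, b₂, rfl, rfl, ha, hb⟩
    exact (R.closed_left ha).pair (S.closed_left hb)
  closed_right := by
    rintro _ _ _ ⟨a₁, b₁, a₂, b₂, rfl, rfl, ha, hb⟩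
    exact (R.closed_right ha).pair (S.closed_right hb)
  mono := by
    rintro _ _ _ _ hj ⟨a₁, b₁, a₂, b₂, rfl, rfl, ha, hb⟩
    exact ⟨a₁, b₁, a₂, b₂, rfl, rfl, R.mono hj ha, S.mono hj hb⟩

/-- Sums of semantic types. -/
def sum (R : SemTy side A₁ A₂) (S : SemTy side B₁ B₂) :
    SemTy side (.sum A₁ B₁) (.sum A₂ B₂) where
  rel i v₁ v₂ := (∃ a₁ a₂, v₁ = .inl a₁ ∧ v₂ = .inl a₂ ∧ R.rel i a₁ a₂) ∨
    ∃ b₁ b₂, v₁ = .inr b₁ ∧ v₂ = .inr b₂ ∧ S.rel i b₁ b₂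
  closed_left := by
    rintro _ _ _ (⟨a₁, a₂, rfl, rfl, h⟩ | ⟨a₁, a₂, rfl, rfl, h⟩)
    · exact (R.closed_left h).inl
    · exact (S.closed_left h).inr
  closed_right := by
    rintro _ _ _ (⟨a₁, a₂, rfl, rfl, h⟩ | ⟨a₁, a₂, rfl, rfl, h⟩)
    · exact (R.closed_right h).inl
    · exact (S.closed_right h).inr
  mono := by
    rintro _ _ _ _ hj (⟨a₁, a₂, rfl, rfl, h⟩ | ⟨a₁, a₂, rfl, rfl, h⟩)
    · exact .inl ⟨a₁, a₂, rfl, rfl, R.mono hj h⟩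
    · exact .inr ⟨a₁, a₂, rfl, rfl, S.mono hj h⟩

/-- Function spaces of semantic types. -/
def arr (R : SemTy side A₁ A₂) (S : SemTy side B₁ B₂) :
    SemTy side (.arr A₁ B₁) (.arr A₂ B₂) where
  rel i v₁ v₂ := ClosedVal (.arr A₁ B₁) v₁ ∧ ClosedVal (.arr A₂ B₂) v₂ ∧
    ∀ j ≤ i, ∀ w₁ w₂, R.rel j w₁ w₂ → S.tm j (.app v₁ w₁) (.app v₂ w₂)
  closed_left h := h.1
  closed_right h := h.2.1
  mono hj h := ⟨h.1, h.2.1, fun k hk => h.2.2 k (hk.trans hj)⟩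

/-! ### Congruence of the term formers -/

variable {R : SemTy side A₁ A₂} {S : SemTy side B₁ B₂} {T : SemTy side C₁ C₂}

theorem tm_inl [HasOutcomes side] (ht : R.tm i t₁ t₂) (h : HasTy [] t₂ A₂) :
    (R.sum S).tm i (.inl t₁) (.inl t₂) :=
  tm_bind (.inl .hole) (.inl .hole) ht (.inl h) fun _ _ v₁ v₂ hv =>
    tm_of_rel (t₁ := .inl v₁) (t₂ := .inl v₂) (.inl ⟨v₁, v₂, rfl, rfl, hv⟩)

theorem tm_inr [HasOutcomes side] (ht : S.tm i t₁ t₂) (h : HasTy [] t₂ B₂) :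
    (R.sum S).tm i (.inr t₁) (.inr t₂) :=
  tm_bind (.inr .hole) (.inr .hole) ht (.inr h) fun _ _ v₁ v₂ hv =>
    tm_of_rel (t₁ := .inr v₁) (t₂ := .inr v₂) (.inr ⟨v₁, v₂, rfl, rfl, hv⟩)

/-- The second component runs on whatever index the first has left, hence the hypothesis at every `j
≤ i`; the first pair of values is carried down by `mono`. -/
theorem tm_pair [HasOutcomes side] (ht : R.tm i t₁ t₂) (hs : ∀ j ≤ i, S.tm j s₁ s₂)
    (h : HasTy [] t₂ A₂) (h' : HasTy [] s₂ B₂) :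
    (R.prod S).tm i (.pair t₁ s₁) (.pair t₂ s₂) :=
  tm_bind (.pairL .hole s₁) (.pairL .hole s₂) ht (.pair h h') fun j hj v₁ v₂ hv =>
    tm_bind (.pairR v₁ (R.closed_left hv).1 .hole) (.pairR v₂ (R.closed_right hv).1 .hole)
      (hs j hj) (.pair (R.closed_right hv).2 h') fun _ hk w₁ w₂ hw =>
      tm_of_rel (t₁ := .pair v₁ w₁) (t₂ := .pair v₂ w₂)
        ⟨v₁, w₁, v₂, w₂, rfl, rfl, R.mono hk hv, hw⟩

theorem tm_app [HasOutcomes side] (ht : (R.arr S).tm i t₁ t₂) (hs : ∀ j ≤ i, R.tm j s₁ s₂)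
    (h : HasTy [] t₂ (.arr A₂ B₂)) (h' : HasTy [] s₂ A₂) :
    S.tm i (.app t₁ s₁) (.app t₂ s₂) :=
  tm_bind (.appL .hole s₁) (.appL .hole s₂) ht (.app h h') fun j hj v₁ v₂ hv =>
    tm_bind (.appR v₁ hv.1.1 .hole) (.appR v₂ hv.2.1.1 .hole)
      (hs j hj) (.app hv.2.1.2 h') fun k hk w₁ w₂ hw => hv.2.2 k hk w₁ w₂ hw

theorem tm_letin [HasOutcomes side] (ht : R.tm i t₁ t₂) (h : HasTy [] (.letin t₂ s₂) C₂)
    (hs : ∀ j ≤ i, ∀ v₁ v₂, R.rel j v₁ v₂ →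
      T.tm j (s₁.subst (single v₁)) (s₂.subst (single v₂))) :
    T.tm i (.letin t₁ s₁) (.letin t₂ s₂) :=
  tm_bind (.letin .hole s₁) (.letin .hole s₂) ht h fun j hj v₁ v₂ hv =>
    tm_of_steps_zero (Red.letin (R.closed_left hv).1).steps (Red.letin (R.closed_right hv).1).steps
      (hs j hj v₁ v₂ hv)

theorem tm_letpair [HasOutcomes side] (ht : (R.prod S).tm i t₁ t₂)
    (h : HasTy [] (.letpair t₂ s₂) C₂)
    (hs : ∀ j ≤ i, ∀ v₁ v₂ w₁ w₂, R.rel j v₁ v₂ → S.rel j w₁ w₂ →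
      T.tm j (s₁.subst (double v₁ w₁)) (s₂.subst (double v₂ w₂))) :
    T.tm i (.letpair t₁ s₁) (.letpair t₂ s₂) := by
  refine tm_bind (.letpair .hole s₁) (.letpair .hole s₂) ht h ?_
  rintro j hj _ _ ⟨v₁, w₁, v₂, w₂, rfl, rfl, hv, hw⟩
  exact tm_of_steps_zero (Red.letpair (R.closed_left hv).1 (S.closed_left hw).1).steps
    (Red.letpair (R.closed_right hv).1 (S.closed_right hw).1).steps (hs j hj _ _ _ _ hv hw)

theorem tm_case [HasOutcomes side] {s₁' s₂' : Tm} (ht : (R.sum S).tm i t₁ t₂)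
    (h : HasTy [] (.case t₂ s₂ s₂') C₂)
    (hs : ∀ j ≤ i, ∀ v₁ v₂, R.rel j v₁ v₂ →
      T.tm j (s₁.subst (single v₁)) (s₂.subst (single v₂)))
    (hs' : ∀ j ≤ i, ∀ v₁ v₂, S.rel j v₁ v₂ →
      T.tm j (s₁'.subst (single v₁)) (s₂'.subst (single v₂))) :
    T.tm i (.case t₁ s₁ s₁') (.case t₂ s₂ s₂') := by
  refine tm_bind (.case .hole s₁ s₁') (.case .hole s₂ s₂') ht h ?_
  rintro j hj _ _ (⟨v₁, v₂, rfl, rfl, hv⟩ | ⟨v₁, v₂, rfl, rfl, hv⟩)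
  · exact tm_of_steps_zero (Red.caseInl (R.closed_left hv).1).steps
      (Red.caseInl (R.closed_right hv).1).steps (hs j hj _ _ hv)
  · exact tm_of_steps_zero (Red.caseInr (S.closed_left hv).1).steps
      (Red.caseInr (S.closed_right hv).1).steps (hs' j hj _ _ hv)

theorem rel_lam (h₁ : HasTy [A₁] t₁ B₁) (h₂ : HasTy [A₂] t₂ B₂)
    (h : ∀ j ≤ i, ∀ v₁ v₂, R.rel j v₁ v₂ →
      S.tm j (t₁.subst (single v₁)) (t₂.subst (single v₂))) :
    (R.arr S).rel i (.lam A₁ t₁) (.lam A₂ t₂) :=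
  ⟨.lam h₁, .lam h₂, fun j hj w₁ w₂ hw =>
    tm_of_steps_zero (Red.beta (R.closed_left hw).1).steps (Red.beta (R.closed_right hw).1).steps
      (h j hj w₁ w₂ hw)⟩

end SemTy

/-! ## The logical relation as a semantic type -/

section

variable {side : Side} {i j : ℕ} {A B : Ty 0} {v₁ v₂ : Tm}

theorem ValRel.closed_left (h : ValRel side i A v₁ v₂) : ClosedVal A v₁ := by
  rw [ValRel.eq_def] at h; exact h.1

theorem ValRel.closed_right (h : ValRel side i A v₁ v₂) : ClosedVal A v₂ := by
  rw [ValRel.eq_def] at h; exact h.2.1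

theorem valRel_mu_zero {A : Ty 1} :
    ValRel side 0 (.mu A) v₁ v₂ ↔ ClosedVal (.mu A) v₁ ∧ ClosedVal (.mu A) v₂ := by
  rw [ValRel.eq_def]; simp

theorem valRel_mu_succ {A : Ty 1} :
    ValRel side (i + 1) (.mu A) v₁ v₂ ↔ ∃ w₁ w₂, v₁ = .roll (.mu A) w₁ ∧
      v₂ = .roll (.mu A) w₂ ∧ ValRel side i A.unfold w₁ w₂ := by
  rw [ValRel.eq_def]
  refine ⟨fun h => h.2.2, ?_⟩
  rintro ⟨w₁, w₂, rfl, rfl, h⟩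
  exact ⟨h.closed_left.roll, h.closed_right.roll, w₁, w₂, rfl, rfl, h⟩

theorem valRel_unit : ValRel side i .unit v₁ v₂ ↔ v₁ = .unit ∧ v₂ = .unit := by
  rw [ValRel.eq_def]
  cases i <;>
  · refine ⟨fun h => h.2.2, ?_⟩
    rintro ⟨rfl, rfl⟩
    exact ⟨⟨.unit, .unit⟩, ⟨.unit, .unit⟩, rfl, rfl⟩

theorem valRel_prod : ValRel side i (.prod A B) v₁ v₂ ↔ ∃ a₁ b₁ a₂ b₂,
    v₁ = .pair a₁ b₁ ∧ v₂ = .pair a₂ b₂ ∧ ValRel side i A a₁ a₂ ∧ ValRel side i B b₁ b₂ := by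
  rw [ValRel.eq_def]
  cases i <;>
  · refine ⟨fun h => h.2.2, ?_⟩
    rintro ⟨a₁, b₁, a₂, b₂, rfl, rfl, ha, hb⟩
    exact ⟨ha.closed_left.pair hb.closed_left, ha.closed_right.pair hb.closed_right,
      a₁, b₁, a₂, b₂, rfl, rfl, ha, hb⟩

theorem valRel_sum : ValRel side i (.sum A B) v₁ v₂ ↔
    (∃ a₁ a₂, v₁ = .inl a₁ ∧ v₂ = .inl a₂ ∧ ValRel side i A a₁ a₂) ∨
    ∃ b₁ b₂, v₁ = .inr b₁ ∧ v₂ = .inr b₂ ∧ ValRel side i B b₁ b₂ := by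
  rw [ValRel.eq_def]
  cases i <;>
  · refine ⟨?_, ?_⟩
    · rintro ⟨-, -, ⟨a₁, a₂, h, rfl, rfl⟩ | ⟨a₁, a₂, h, rfl, rfl⟩⟩
      · exact .inl ⟨a₁, a₂, rfl, rfl, h⟩
      · exact .inr ⟨a₁, a₂, rfl, rfl, h⟩
    · rintro (⟨a₁, a₂, rfl, rfl, h⟩ | ⟨a₁, a₂, rfl, rfl, h⟩)
      · exact ⟨h.closed_left.inl, h.closed_right.inl, .inl ⟨a₁, a₂, h, rfl, rfl⟩⟩
      · exact ⟨h.closed_left.inr, h.closed_right.inr, .inr ⟨a₁, a₂, h, rfl, rfl⟩⟩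

theorem valRel_arr : ValRel side i (.arr A B) v₁ v₂ ↔
    ClosedVal (.arr A B) v₁ ∧ ClosedVal (.arr A B) v₂ ∧ ∀ j ≤ i, ∀ w₁ w₂,
      ValRel side j A w₁ w₂ → TermRel side j B (.app v₁ w₁) (.app v₂ w₂) := by
  rw [ValRel.eq_def]
  cases i <;> rfl

/-- The recursion follows that of the relation: unfolding may enlarge the type but lowers the index.
Function types need no recursive call, because their clause already quantifies over all smaller
indices. -/
theorem ValRel.mono {side : Side} {i j : ℕ} {A : Ty 0} {v₁ v₂ : Tm} (hj : j ≤ i)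
    (h : ValRel side i A v₁ v₂) : ValRel side j A v₁ v₂ := by
  match i, j, A, hj, h with
  | i, 0, .mu A, _, h => exact valRel_mu_zero.2 ⟨h.closed_left, h.closed_right⟩
  | i + 1, j + 1, .mu A, hj, h =>
    obtain ⟨w₁, w₂, e₁, e₂, h⟩ := valRel_mu_succ.1 h
    exact valRel_mu_succ.2 ⟨w₁, w₂, e₁, e₂, h.mono (Nat.le_of_succ_le_succ hj)⟩
  | i, j, .unit, _, h => exact valRel_unit.2 (valRel_unit.1 h)
  | i, j, .prod A B, hj, h =>
    obtain ⟨a₁, b₁, a₂, b₂, e₁, e₂, ha, hb⟩ := valRel_prod.1 h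
    exact valRel_prod.2 ⟨a₁, b₁, a₂, b₂, e₁, e₂, ha.mono hj, hb.mono hj⟩
  | i, j, .sum A B, hj, h =>
    rcases valRel_sum.1 h with ⟨a₁, a₂, e₁, e₂, h⟩ | ⟨a₁, a₂, e₁, e₂, h⟩
    · exact valRel_sum.2 (.inl ⟨a₁, a₂, e₁, e₂, h.mono hj⟩)
    · exact valRel_sum.2 (.inr ⟨a₁, a₂, e₁, e₂, h.mono hj⟩)
  | i, j, .arr A B, hj, h =>
    obtain ⟨h₁, h₂, h⟩ := valRel_arr.1 h
    exact valRel_arr.2 ⟨h₁, h₂, fun k hk => h k (hk.trans hj)⟩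
termination_by (i, sizeOf A)
decreasing_by
  all_goals simp [Prod.lex_def] <;> omega

end

/-- The logical relation at a type. -/
def SemTy.ofTy (side : Side) (A : Ty 0) : SemTy side A A where
  rel i := ValRel side i A
  closed_left := ValRel.closed_left
  closed_right := ValRel.closed_right
  mono := ValRel.mono

section

variable {side : Side} {i : ℕ} {A B : Ty 0} {v₁ v₂ : Tm}

theorem termRel_iff {t₁ t₂ : Tm} : TermRel side i A t₁ t₂ ↔
    HasTy [] t₁ A ∧ HasTy [] t₂ A ∧ (SemTy.ofTy side A).tm i t₁ t₂ := by
  cases side <;> rfl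

theorem SemTy.ofTy_prod : ofTy side (.prod A B) = (ofTy side A).prod (ofTy side B) := by
  unfold ofTy prod
  congr 1
  funext i v₁ v₂
  exact propext valRel_prod

theorem SemTy.ofTy_sum : ofTy side (.sum A B) = (ofTy side A).sum (ofTy side B) := by
  unfold ofTy sum
  congr 1
  funext i v₁ v₂
  exact propext valRel_sum

theorem SemTy.ofTy_arr : ofTy side (.arr A B) = (ofTy side A).arr (ofTy side B) := by
  unfold ofTy arr
  congr 1
  funext i v₁ v₂
  refine propext (valRel_arr.trans ?_)
  refine and_congr_right fun h₁ => and_congr_right fun h₂ => ?_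
  refine forall₄_congr fun j _ w₁ w₂ => forall_congr' fun hw => ?_
  -- `TermRel` carries typing conjuncts that `SemTy.tm` omits; for applications of closed values
  -- they hold automatically.
  rw [termRel_iff]
  exact ⟨fun h => h.2.2, fun h => ⟨.app h₁.2 (ValRel.closed_left hw).2,
    .app h₂.2 (ValRel.closed_right hw).2, h⟩⟩

end

/-! ## Outcomes of well-typed terms -/

theorem SubstRel.mono {side : Side} {i j : ℕ} {Γ : List (Ty 0)} {γ₁ γ₂ : ℕ → Tm} (hj : j ≤ i)
    (h : SubstRel side i Γ γ₁ γ₂) : SubstRel side j Γ γ₁ γ₂ :=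
  fun n A hn => (h n A hn).mono hj

theorem SubstRel.scons {side : Side} {i : ℕ} {Γ : List (Ty 0)} {γ₁ γ₂ : ℕ → Tm} {A : Ty 0}
    {v₁ v₂ : Tm} (h : SubstRel side i Γ γ₁ γ₂) (hv : ValRel side i A v₁ v₂) :
    SubstRel side i (A :: Γ) (scons v₁ γ₁) (scons v₂ γ₂) := by
  intro n B hn
  cases n with
  | zero => cases hn; exact hv
  | succ n => exact h n B hn

theorem HasTy.subst_up {Γ : List (Ty 0)} {t : Tm} {A B : Ty 0} {σ : ℕ → Tm}
    (h : HasTy (A :: Γ) t B) (hσ : ∀ n B, Γ[n]? = some B → HasTy [] (σ n) B) :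
    HasTy [A] (t.subst (up σ)) B := by
  refine h.subst fun n C hn => ?_
  cases n with
  | zero => exact .var hn
  | succ n => exact (hσ n C hn).rename nofun

/-- On the side `prec`, well-typed terms are related to themselves. -/
theorem HasTy.tm_prec {Γ : List (Ty 0)} {t : Tm} {A : Ty 0} (h : HasTy Γ t A) :
    ∀ {i : ℕ} {γ₁ γ₂ : ℕ → Tm}, SubstRel .prec i Γ γ₁ γ₂ →
      (SemTy.ofTy .prec A).tm i (t.subst γ₁) (t.subst γ₂) := by
  have ty₁ : ∀ {Γ t A}, HasTy Γ t A → ∀ {i γ₁ γ₂}, SubstRel .prec i Γ γ₁ γ₂ →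
      HasTy [] (t.subst γ₁) A := fun h _ _ _ hγ =>
    h.subst fun n B hn => (hγ n B hn).closed_left.2
  have ty₂ : ∀ {Γ t A}, HasTy Γ t A → ∀ {i γ₁ γ₂}, SubstRel .prec i Γ γ₁ γ₂ →
      HasTy [] (t.subst γ₂) A := fun h _ _ _ hγ =>
    h.subst fun n B hn => (hγ n B hn).closed_right.2
  induction h with
  | err => intros; exact SemTy.tm_err _
  | var h => intro i γ₁ γ₂ hγ; exact SemTy.tm_of_rel (hγ _ _ h)
  | letin ht hs iht ihs =>
    intro i γ₁ γ₂ hγ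
    refine SemTy.tm_letin (iht hγ) (ty₂ (.letin ht hs) hγ) fun j hj v₁ v₂ hv => ?_
    rw [Tm.subst_up_single, Tm.subst_up_single]
    exact ihs ((hγ.mono hj).scons hv)
  | roll ht ih =>
    intro i γ₁ γ₂ hγ
    refine SemTy.tm_bind (.roll _ .hole) (.roll _ .hole) (ih hγ) (ty₂ (.roll ht) hγ) ?_
    intro j hj v₁ v₂ hv
    -- Rolling gains an index: contents related at `j` give rolled values related at `j + 1`.
    refine SemTy.tm_of_rel (ValRel.mono j.le_succ (valRel_mu_succ.2 ⟨v₁, v₂, rfl, rfl, hv⟩))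
  | unroll ht ih =>
    intro i γ₁ γ₂ hγ
    refine SemTy.tm_bind (.unroll .hole) (.unroll .hole) (ih hγ) (ty₂ (.unroll ht) hγ) ?_
    intro j hj v₁ v₂ hv
    obtain ⟨w₁, rfl, hw₁⟩ := (ValRel.closed_left hv).mu_inv
    obtain ⟨w₂, rfl, hw₂⟩ := (ValRel.closed_right hv).mu_inv
    refine SemTy.tm_of_steps_one (Red.unroll hw₁.1).steps (Red.unroll hw₂.1).steps ?_
    rintro k rfl
    obtain ⟨_, _, e₁, e₂, hw⟩ := valRel_mu_succ.1 hv
    cases e₁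
    cases e₂
    exact SemTy.tm_of_rel hw
  | unit => intros; exact SemTy.tm_of_rel (valRel_unit.2 ⟨rfl, rfl⟩)
  | pair ht hs iht ihs =>
    intro i γ₁ γ₂ hγ
    rw [SemTy.ofTy_prod]
    exact SemTy.tm_pair (iht hγ) (fun j hj => ihs (hγ.mono hj)) (ty₂ ht hγ) (ty₂ hs hγ)
  | letpair ht hs iht ihs =>
    intro i γ₁ γ₂ hγ
    rw [SemTy.ofTy_prod] at iht
    refine SemTy.tm_letpair (iht hγ) (ty₂ (.letpair ht hs) hγ) fun j hj v₁ v₂ w₁ w₂ hv hw => ?_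
    rw [Tm.subst_up_up_double, Tm.subst_up_up_double]
    exact ihs (((hγ.mono hj).scons hv).scons hw)
  | inl ht ih =>
    intro i γ₁ γ₂ hγ
    rw [SemTy.ofTy_sum]
    exact SemTy.tm_inl (ih hγ) (ty₂ ht hγ)
  | inr ht ih =>
    intro i γ₁ γ₂ hγ
    rw [SemTy.ofTy_sum]
    exact SemTy.tm_inr (ih hγ) (ty₂ ht hγ)
  | case ht hs hs' iht ihs ihs' =>
    intro i γ₁ γ₂ hγ
    rw [SemTy.ofTy_sum] at iht
    refine SemTy.tm_case (iht hγ) (ty₂ (.case ht hs hs') hγ) (fun j hj v₁ v₂ hv => ?_)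
      fun j hj v₁ v₂ hv => ?_
    · rw [Tm.subst_up_single, Tm.subst_up_single]
      exact ihs ((hγ.mono hj).scons hv)
    · rw [Tm.subst_up_single, Tm.subst_up_single]
      exact ihs' ((hγ.mono hj).scons hv)
  | lam ht ih =>
    intro i γ₁ γ₂ hγ
    rw [SemTy.ofTy_arr]
    refine SemTy.tm_of_rel (SemTy.rel_lam
      (ht.subst_up fun n B hn => (hγ n B hn).closed_left.2)
      (ht.subst_up fun n B hn => (hγ n B hn).closed_right.2) fun j hj v₁ v₂ hv => ?_)
    rw [Tm.subst_up_single, Tm.subst_up_single]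
    exact ih ((hγ.mono hj).scons hv)
  | app ht hs iht ihs =>
    intro i γ₁ γ₂ hγ
    rw [SemTy.ofTy_arr] at iht
    exact SemTy.tm_app (iht hγ) (fun j hj => ihs (hγ.mono hj)) (ty₂ ht hγ) (ty₂ hs hγ)

/-- On `prec` the clauses say about the left term what an outcome requires, so relating a term to
itself gives type safety. -/
theorem HasTy.outcome {A : Ty 0} {t : Tm} (h : HasTy [] t A) : Outcome A t := by
  intro i
  have := h.tm_prec (i := i) (γ₁ := .var) (γ₂ := .var) nofun
  rw [Tm.subst_var] at this
  rcases this with h | h | ⟨j, hj, v₁, v₂, hv, h, -⟩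
  · exact .inl h
  · exact .inr (.inl h)
  · exact .inr (.inr ⟨j, hj, v₁, ValRel.closed_left hv, h⟩)

instance (side : Side) : HasOutcomes side := ⟨fun _ _ _ h => h.outcome⟩

/-! ## The dynamic type -/

/-- Tagging as an operation on terms. -/
def Tag.inj (G : Tag) (t : Tm) : Tm := (tagCtx G).plug t

theorem Tag.inj_isValue {G : Tag} {v : Tm} (hv : IsValue v) : IsValue (G.inj v) := by
  cases G
  exacts [.roll _ (.inl hv), .roll _ (.inr (.inl hv)), .roll _ (.inr (.inr (.inl hv))),
    .roll _ (.inr (.inr (.inr hv)))]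

theorem Tag.inj_hasTy {G : Tag} {Γ : List (Ty 0)} {t : Tm} (h : HasTy Γ t G.ty.tr) :
    HasTy Γ (G.inj t) dynTy := by
  cases G
  exacts [.roll (.inl h), .roll (.inr (.inl h)), .roll (.inr (.inr (.inl h))),
    .roll (.inr (.inr (.inr h)))]

theorem ClosedVal.inj {G : Tag} {v : Tm} (h : ClosedVal G.ty.tr v) : ClosedVal dynTy (G.inj v) :=
  ⟨G.inj_isValue h.1, G.inj_hasTy h.2⟩

theorem Tag.inj_injective {G G' : Tag} {t t' : Tm} (h : G.inj t = G'.inj t') :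
    G = G' ∧ t = t' := by
  cases G <;> cases G' <;> simp_all [Tag.inj, tagCtx, ECtx.plug]

theorem ClosedVal.dyn_inv {v : Tm} (h : ClosedVal dynTy v) :
    ∃ (G : Tag) (w : Tm), v = G.inj w ∧ ClosedVal G.ty.tr w := by
  obtain ⟨w, rfl, hw⟩ := h.mu_inv
  rcases ClosedVal.sum_inv hw with ⟨a, rfl, ha⟩ | ⟨b, rfl, hb⟩
  · exact ⟨.unit, a, rfl, ha⟩
  rcases ClosedVal.sum_inv hb with ⟨a, rfl, ha⟩ | ⟨c, rfl, hc⟩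
  · exact ⟨.prod, a, rfl, ha⟩
  rcases ClosedVal.sum_inv hc with ⟨a, rfl, ha⟩ | ⟨d, rfl, hd⟩
  · exact ⟨.sum, a, rfl, ha⟩
  · exact ⟨.arr, d, rfl, hd⟩

theorem valRel_dyn_succ {side : Side} {i : ℕ} {v₁ v₂ : Tm} :
    ValRel side (i + 1) dynTy v₁ v₂ ↔ ∃ (G : Tag) (w₁ w₂ : Tm), v₁ = G.inj w₁ ∧ v₂ = G.inj w₂ ∧
      ValRel side i G.ty.tr w₁ w₂ := by
  refine valRel_mu_succ.trans ⟨?_, ?_⟩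
  · rintro ⟨_, _, rfl, rfl, h⟩
    rcases valRel_sum.1 h with ⟨w₁, w₂, rfl, rfl, h₁⟩ | ⟨_, _, rfl, rfl, h₁⟩
    · exact ⟨.unit, w₁, w₂, rfl, rfl, h₁⟩
    rcases valRel_sum.1 h₁ with ⟨w₁, w₂, rfl, rfl, h₂⟩ | ⟨_, _, rfl, rfl, h₂⟩
    · exact ⟨.prod, w₁, w₂, rfl, rfl, h₂⟩
    rcases valRel_sum.1 h₂ with ⟨w₁, w₂, rfl, rfl, h₃⟩ | ⟨w₁, w₂, rfl, rfl, h₃⟩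
    · exact ⟨.sum, w₁, w₂, rfl, rfl, h₃⟩
    · exact ⟨.arr, w₁, w₂, rfl, rfl, h₃⟩
  · rintro ⟨G, w₁, w₂, rfl, rfl, h⟩
    cases G
    · exact ⟨_, _, rfl, rfl, valRel_sum.2 (.inl ⟨w₁, w₂, rfl, rfl, h⟩)⟩
    · exact ⟨_, _, rfl, rfl, valRel_sum.2 (.inr ⟨_, _, rfl, rfl, valRel_sum.2
        (.inl ⟨w₁, w₂, rfl, rfl, h⟩)⟩)⟩
    · exact ⟨_, _, rfl, rfl, valRel_sum.2 (.inr ⟨_, _, rfl, rfl, valRel_sum.2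
        (.inr ⟨_, _, rfl, rfl, valRel_sum.2 (.inl ⟨w₁, w₂, rfl, rfl, h⟩)⟩)⟩)⟩
    · exact ⟨_, _, rfl, rfl, valRel_sum.2 (.inr ⟨_, _, rfl, rfl, valRel_sum.2
        (.inr ⟨_, _, rfl, rfl, valRel_sum.2 (.inr ⟨w₁, w₂, rfl, rfl, h⟩)⟩)⟩)⟩

theorem untagCtx_hasTy {G : Tag} {Γ : List (Ty 0)} {t : Tm} (h : HasTy Γ t dynTy) :
    HasTy Γ ((untagCtx G).plug t) G.ty.tr := by
  have h : HasTy Γ (.unroll t) (.sum .unit (.sum (.prod dynTy dynTy)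
    (.sum (.sum dynTy dynTy) (.arr dynTy dynTy)))) := .unroll h
  cases G
  · exact .case h (.var rfl) (.case (.var rfl) .err (.case (.var rfl) .err .err))
  · exact .case h .err (.case (.var rfl) (.var rfl) (.case (.var rfl) .err .err))
  · exact .case h .err (.case (.var rfl) .err (.case (.var rfl) (.var rfl) .err))
  · exact .case h .err (.case (.var rfl) .err (.case (.var rfl) .err (.var rfl)))

/-- The weight is that of the single unrolling, whether or not the tags agree; matching on the sum
is free. -/
theorem untagCtx_steps {G G' : Tag} {v : Tm} (hv : IsValue v) :
    Steps 1 ((untagCtx G).plug (G'.inj v)) (if G' = G then v else .err) := by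
  have unroll : ∀ (w b b' : Tm), IsValue w →
      Steps 1 (.case (.unroll (.roll dynTy w)) b b') (.case w b b') := fun w b b' hw =>
    (Red.unroll (A := dynTy) hw).steps.plug (.case .hole b b') hw.ne_err
  cases G' <;> refine (unroll _ _ _ ?_).trans_zero ?_
  · exact .inl hv
  · refine (Red.caseInl hv).steps.trans_zero ?_
    cases G <;> exact .refl _
  · exact .inr (.inl hv)
  · refine (Red.caseInr (.inl hv)).steps.trans_zero ((Red.caseInl hv).steps.trans_zero ?_)
    cases G <;> exact .refl _
  · exact .inr (.inr (.inl hv))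
  · refine (Red.caseInr (.inr (.inl hv))).steps.trans_zero
      ((Red.caseInr (.inl hv)).steps.trans_zero ((Red.caseInl hv).steps.trans_zero ?_))
    cases G <;> exact .refl _
  · exact .inr (.inr (.inr hv))
  · refine (Red.caseInr (.inr (.inr hv))).steps.trans_zero
      ((Red.caseInr (.inr hv)).steps.trans_zero ((Red.caseInr hv).steps.trans_zero ?_))
    cases G <;> exact .refl _

theorem untagCtx_steps_self {G : Tag} {v : Tm} (hv : IsValue v) :
    Steps 1 ((untagCtx G).plug (G.inj v)) v := by
  simpa using untagCtx_steps (G := G) (G' := G) hv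

theorem untagCtx_steps_ne {G G' : Tag} {v : Tm} (hG : G' ≠ G) (hv : IsValue v) :
    Steps 1 ((untagCtx G).plug (G'.inj v)) .err := by
  simpa [hG] using untagCtx_steps (G := G) (G' := G') hv

/-! ## Semantics of type dynamism -/

/-- The index left for the content of a tagged value. -/
def Side.pred : Side → ℕ → ℕ
  | .prec, i => i
  | .succ, i => i - 1

theorem Side.pred_mono (side : Side) {i j : ℕ} (h : j ≤ i) : side.pred j ≤ side.pred i := by
  cases side
  · exact h
  · exact Nat.sub_le_sub_right h 1

/-- Values related to tagged values. Unrolling the latter is counted on the side `succ` only. -/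
def SemTy.tag {side : Side} {A : Ty 0} (G : Tag) (R : SemTy side A G.ty.tr) :
    SemTy side A dynTy where
  rel i v₁ v₂ := ClosedVal A v₁ ∧ ClosedVal dynTy v₂ ∧
    -- On `succ` the rolled value is on the counted side, so its content is seen one index later and
    -- index 0 gives no information, as for recursive types. On `prec` the left value need not be
    -- rolled, and nothing is charged.
    ((side = .succ ∧ i = 0) ∨ ∃ w, v₂ = G.inj w ∧ R.rel (side.pred i) v₁ w)
  closed_left h := h.1
  closed_right h := h.2.1
  mono := by
    rintro i j v₁ v₂ hj ⟨h₁, h₂, ⟨hs, rfl⟩ | ⟨w, e, h⟩⟩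
    · exact ⟨h₁, h₂, .inl ⟨hs, by omega⟩⟩
    · exact ⟨h₁, h₂, .inr ⟨w, e, R.mono (side.pred_mono hj) h⟩⟩

/-- The relation between values of `A` and values of `B` that is denoted by `A ⊑ B`. -/
def Deriv.sem (side : Side) : {A B : GTy} → Deriv A B → SemTy side A.tr B.tr
  | _, _, .idUnit => .ofTy side .unit
  | _, _, .idDyn => .ofTy side dynTy
  | _, _, .tag G _ c => .tag G (c.sem side)
  | _, _, .prod c d => (c.sem side).prod (d.sem side)
  | _, _, .sum c d => (c.sem side).sum (d.sem side)
  | _, _, .arr c d => (c.sem side).arr (d.sem side)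

/-- Identifies the homogeneous relation as a case of the heterogeneous one. Instances of `castRel`
with a reflexive derivation at one end are thereby statements about the logical relation. -/
theorem Deriv.sem_id (side : Side) (A : GTy) : (Deriv.id A).sem side = .ofTy side A.tr := by
  induction A with
  | dyn => rfl
  | unit => rfl
  | prod A B ihA ihB => simp only [Deriv.id, Deriv.sem, ihA, ihB]; exact SemTy.ofTy_prod.symm
  | sum A B ihA ihB => simp only [Deriv.id, Deriv.sem, ihA, ihB]; exact SemTy.ofTy_sum.symm
  | arr A B ihA ihB => simp only [Deriv.id, Deriv.sem, ihA, ihB]; exact SemTy.ofTy_arr.symm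

/-! ## Contexts that implement casts -/

/-- The contexts that implement the cast from `A` to `B`, with or without expanding identities. -/
inductive Impl : GTy → GTy → ECtx → Prop
  | hole (A : GTy) : Impl A A .hole
  | prod {A B A' B' : GTy} {E E' : ECtx} : Impl A B E → Impl A' B' E' →
      Impl (.prod A A') (.prod B B') (prodCtx E E')
  | sum {A B A' B' : GTy} {E E' : ECtx} : Impl A B E → Impl A' B' E' →
      Impl (.sum A A') (.sum B B') (sumCtx E E')
  | arr {A B A' B' : GTy} {E E' : ECtx} : Impl B A E → Impl A' B' E' →
      Impl (.arr A A') (.arr B B') (arrCtx B.tr E E')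
  | tag {A : GTy} {G : Tag} {E : ECtx} : A.tag? = some G → Impl A G.ty E →
      Impl A .dyn ((tagCtx G).comp E)
  | untag {B : GTy} {G : Tag} {E : ECtx} : B.tag? = some G → Impl G.ty B E →
      Impl .dyn B (E.comp (untagCtx G))
  | fail {A B : GTy} {G G' : Tag} : A.tag? = some G → B.tag? = some G' → G ≠ G' →
      Impl A B (.letin .hole .err)

theorem castCtx_impl (A B : GTy) : Impl A B (castCtx A B) := by
  fun_induction castCtx A B with
  | case1 | case2 => exact .hole _
  | case3 _ _ _ _ ih ih' => exact .prod ih ih'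
  | case4 _ _ _ _ ih ih' => exact .sum ih ih'
  | case5 _ _ _ _ ih ih' => exact .arr ih ih'
  | case6 => exact .tag (G := .unit) (E := .hole) rfl (.hole _)
  | case7 _ _ h =>
    obtain ⟨rfl, rfl⟩ := h
    exact .tag (G := .prod) (E := .hole) rfl (.hole _)
  | case9 _ _ h =>
    obtain ⟨rfl, rfl⟩ := h
    exact .tag (G := .sum) (E := .hole) rfl (.hole _)
  | case11 _ _ h =>
    obtain ⟨rfl, rfl⟩ := h
    exact .tag (G := .arr) (E := .hole) rfl (.hole _)
  | case8 _ _ _ ih | case10 _ _ _ ih | case12 _ _ _ ih => exact .tag rfl ih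
  | case13 => exact .untag (G := .unit) (E := .hole) rfl (.hole _)
  | case14 _ _ h =>
    obtain ⟨rfl, rfl⟩ := h
    exact .untag (G := .prod) (E := .hole) rfl (.hole _)
  | case16 _ _ h =>
    obtain ⟨rfl, rfl⟩ := h
    exact .untag (G := .sum) (E := .hole) rfl (.hole _)
  | case18 _ _ h =>
    obtain ⟨rfl, rfl⟩ := h
    exact .untag (G := .arr) (E := .hole) rfl (.hole _)
  | case15 _ _ _ ih | case17 _ _ _ ih | case19 _ _ _ ih => exact .untag rfl ih
  -- Of the 25 pairs of outermost connectives only the 12 with distinct tags reach the default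
  -- clause; the others contradict one of its hypotheses.
  | case20 A B h₁ h₂ h₃ h₄ h₅ h₆ h₇ h₈ h₉ k₁ k₂ k₃ k₄ =>
    cases A <;> cases B
    exacts [(h₁ rfl rfl).elim, (k₁ rfl rfl).elim, (k₂ _ _ rfl rfl).elim, (k₃ _ _ rfl rfl).elim,
      (k₄ _ _ rfl rfl).elim,
      (h₆ rfl rfl).elim, (h₂ rfl rfl).elim, .fail rfl rfl nofun, .fail rfl rfl nofun,
      .fail rfl rfl nofun,
      (h₇ _ _ rfl rfl).elim, .fail rfl rfl nofun, (h₃ _ _ _ _ rfl rfl).elim,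
      .fail rfl rfl nofun, .fail rfl rfl nofun,
      (h₈ _ _ rfl rfl).elim, .fail rfl rfl nofun, .fail rfl rfl nofun,
      (h₄ _ _ _ _ rfl rfl).elim, .fail rfl rfl nofun,
      (h₉ _ _ rfl rfl).elim, .fail rfl rfl nofun, .fail rfl rfl nofun, .fail rfl rfl nofun,
      (h₅ _ _ _ _ rfl rfl).elim]

/-- `castCtx` stops at a tag type, whereas the contexts of a derivation continue with componentwise
identities. Since `Impl` admits both, one theorem covers explicit casts and upcasts. Both modes are
treated together because `→` swaps them. -/
theorem Deriv.ctx_impl {A B : GTy} (c : Deriv A B) :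
    Impl A B (c.ctx .emb) ∧ Impl B A (c.ctx .prj) := by
  induction c with
  | idUnit | idDyn => exact ⟨.hole _, .hole _⟩
  | tag G h c ih => exact ⟨.tag h ih.1, .untag h ih.2⟩
  | prod c d ihc ihd => exact ⟨.prod ihc.1 ihd.1, .prod ihc.2 ihd.2⟩
  | sum c d ihc ihd => exact ⟨.sum ihc.1 ihd.1, .sum ihc.2 ihd.2⟩
  | arr c d ihc ihd => exact ⟨.arr ihc.2 ihd.1, .arr ihc.1 ihd.2⟩

theorem tag?_ty (G : Tag) : G.ty.tag? = some G := by cases G <;> rfl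

namespace Impl

variable {A B A' B' : GTy} {F : ECtx}

theorem hasTy (h : Impl A B F) : ∀ {Γ : List (Ty 0)} {t : Tm}, HasTy Γ t A.tr →
    HasTy Γ (F.plug t) B.tr := by
  induction h with
  | hole => exact fun h => h
  | prod _ _ ih ih' => exact fun h => .letpair h (.pair (ih (.var rfl)) (ih' (.var rfl)))
  | sum _ _ ih ih' => exact fun h => .case h (.inl (ih (.var rfl))) (.inr (ih' (.var rfl)))
  | arr _ _ ih ih' =>
    exact fun h => .letin h (.lam (ih' (.app (.var rfl) (ih (.var rfl)))))
  | tag _ _ ih => intro Γ t h; rw [ECtx.plug_comp]; exact Tag.inj_hasTy (ih h)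
  | untag _ _ ih => intro Γ t h; rw [ECtx.plug_comp]; exact ih (untagCtx_hasTy h)
  | fail => exact fun h => .letin h .err

/-- Cast contexts have no free variables, so a substitution reaches only the hole. The β-reductions
of casts are computed with this. -/
theorem subst_plug (h : Impl A B F) : ∀ (t : Tm) (σ : ℕ → Tm),
    (F.plug t).subst σ = F.plug (t.subst σ) := by
  induction h with
  | hole => intros; rfl
  | prod _ _ ih ih' | sum _ _ ih ih' =>
    intro t σ
    simp [prodCtx, sumCtx, ECtx.plug, Tm.subst, ih, ih', up, Tm.rename]
  | arr _ _ ih ih' =>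
    intro t σ
    simp [arrCtx, ECtx.plug, Tm.subst, ih, ih', up, Tm.rename]
  | @tag _ G _ _ _ ih =>
    intro t σ
    rw [ECtx.plug_comp, ECtx.plug_comp, ← ih]
    cases G <;> rfl
  | @untag _ G _ _ _ ih =>
    intro t σ
    rw [ECtx.plug_comp, ECtx.plug_comp, ih]
    congr 1
    cases G <;> rfl
  | fail => intros; rfl

theorem unit_inv (h : Impl .unit .unit F) : F = .hole := by
  cases h with
  | hole => rfl
  | fail h h' hG => cases h; cases h'; exact (hG rfl).elim

theorem prodCtx_steps {E E' : ECtx} {v v' : Tm} (h : Impl A B E) (h' : Impl A' B' E')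
    (hv : IsValue v) (hv' : IsValue v') :
    Steps 0 ((prodCtx E E').plug (.pair v v')) (.pair (E.plug v) (E'.plug v')) := by
  have := (Red.letpair (t := .pair (E.plug (.var 1)) (E'.plug (.var 0))) hv hv').steps
  simp only [Tm.subst, h.subst_plug, h'.subst_plug, double] at this
  exact this

theorem sumCtx_steps_inl {E E' : ECtx} {v : Tm} (h : Impl A B E) (hv : IsValue v) :
    Steps 0 ((sumCtx E E').plug (.inl v)) (.inl (E.plug v)) := by
  have := (Red.caseInl (t := .inl (E.plug (.var 0))) (t' := .inr (E'.plug (.var 0))) hv).steps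
  simp only [Tm.subst, h.subst_plug, single] at this
  exact this

theorem sumCtx_steps_inr {E E' : ECtx} {v : Tm} (h : Impl A B E') (hv : IsValue v) :
    Steps 0 ((sumCtx E E').plug (.inr v)) (.inr (E'.plug v)) := by
  have := (Red.caseInr (t := .inl (E.plug (.var 0))) (t' := .inr (E'.plug (.var 0))) hv).steps
  simp only [Tm.subst, h.subst_plug, single] at this
  exact this

/-- An identity context at a product type passes for a pair of identity contexts, since no step is
needed on a pair. Its uses need not distinguish the two shapes. -/
theorem prod_inv (h : Impl (.prod A A') (.prod B B') F) : ∃ E E', Impl A B E ∧ Impl A' B' E' ∧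
    ∀ v v', IsValue v → IsValue v' →
      Steps 0 (F.plug (.pair v v')) (.pair (E.plug v) (E'.plug v')) := by
  cases h with
  | hole => exact ⟨_, _, .hole _, .hole _, fun _ _ _ _ => .refl _⟩
  | prod h h' => exact ⟨_, _, h, h', fun v v' hv hv' => prodCtx_steps h h' hv hv'⟩
  | fail h h' hG => cases h; cases h'; exact (hG rfl).elim

theorem sum_inv (h : Impl (.sum A A') (.sum B B') F) : ∃ E E', Impl A B E ∧ Impl A' B' E' ∧
    (∀ v, IsValue v → Steps 0 (F.plug (.inl v)) (.inl (E.plug v))) ∧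
    ∀ v, IsValue v → Steps 0 (F.plug (.inr v)) (.inr (E'.plug v)) := by
  cases h with
  | hole => exact ⟨_, _, .hole _, .hole _, fun _ _ => .refl _, fun _ _ => .refl _⟩
  | sum h h' =>
    exact ⟨_, _, h, h', fun v hv => sumCtx_steps_inl h hv, fun v hv => sumCtx_steps_inr h' hv⟩
  | fail h h' hG => cases h; cases h'; exact (hG rfl).elim

/-- The witness `u` is `v` itself for the identity context and the wrapping λ otherwise; only its
behaviour on values matters. -/
theorem arr_inv (h : Impl (.arr A A') (.arr B B') F) : ∃ E E', Impl B A E ∧ Impl A' B' E' ∧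
    ∀ v, ClosedVal (GTy.arr A A').tr v → ∃ u, ClosedVal (GTy.arr B B').tr u ∧
      Steps 0 (F.plug v) u ∧
      ∀ w, IsValue w → Steps 0 (.app u w) (E'.plug (.app v (E.plug w))) := by
  cases h with
  | hole => exact ⟨_, _, .hole _, .hole _, fun v hv => ⟨v, hv, .refl _, fun _ _ => .refl _⟩⟩
  | @arr _ _ _ _ E E' h h' =>
    refine ⟨E, E', h, h', fun v hv => ?_⟩
    refine ⟨.lam B.tr (E'.plug (.app (v.rename Nat.succ) (E.plug (.var 0)))), .lam ?_, ?_, ?_⟩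
    · exact h'.hasTy (.app (hv.2.rename nofun) (h.hasTy (.var rfl)))
    · have := (Red.letin (s := .lam B.tr (E'.plug (.app (.var 1) (E.plug (.var 0))))) hv.1).steps
      simp only [Tm.subst, h.subst_plug, h'.subst_plug, up, single] at this
      exact this
    · intro w hw
      have := (Red.beta (A := B.tr)
        (t := E'.plug (.app (v.rename Nat.succ) (E.plug (.var 0)))) hw).steps
      simpa only [Tm.subst, h.subst_plug, h'.subst_plug, single, Tm.rename_succ_subst_single]
        using this
  | fail h h' hG => cases h; cases h'; exact (hG rfl).elim

theorem eq_hole (h : Impl A B F) (hA : A.tag? = none) (hB : B.tag? = none) : F = .hole := by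
  cases h with
  | hole => rfl
  | prod | sum | arr => cases hA
  | tag h | fail h => cases h.symm.trans hA
  | untag h => cases h.symm.trans hB

theorem to_dyn_inv {G : Tag} (hA : A.tag? = some G) (h : Impl A .dyn F) :
    ∃ E, F = (tagCtx G).comp E ∧ Impl A G.ty E := by
  cases h with
  | hole => cases hA
  | tag h h' => obtain rfl := Option.some.inj (h.symm.trans hA); exact ⟨_, rfl, h'⟩
  | untag => cases hA
  | fail _ h => cases h

theorem from_dyn_inv {G : Tag} (hB : B.tag? = some G) (h : Impl .dyn B F) :
    ∃ E, F = E.comp (untagCtx G) ∧ Impl G.ty B E := by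
  cases h with
  | hole => cases hB
  | untag h h' => obtain rfl := Option.some.inj (h.symm.trans hB); exact ⟨_, rfl, h'⟩
  | tag => cases hB
  | fail h => cases h

theorem fail_inv {G G' : Tag} (hA : A.tag? = some G) (hB : B.tag? = some G') (hG : G ≠ G')
    (h : Impl A B F) : F = .letin .hole .err := by
  cases h with
  | fail => rfl
  | tag => cases hB
  | untag => cases hA
  | hole | prod | sum | arr => simp_all [GTy.tag?]

/-- Casting a value fails or returns a value. -/
theorem total (h : Impl A B F) : ∀ {v : Tm}, ClosedVal A.tr v →
    Reduces (F.plug v) .err ∨ ∃ w, ClosedVal B.tr w ∧ Reduces (F.plug v) w := by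
  induction h with
  | hole => exact fun h => .inr ⟨_, h, .refl _⟩
  | @prod _ _ _ _ E E' h h' ih ih' =>
    intro v hv
    obtain ⟨a, b, rfl, ha, hb⟩ := ClosedVal.prod_inv hv
    have s := (prodCtx_steps h h' ha.1 hb.1).reduces
    rcases ih ha with e | ⟨a', ha', e⟩
    · exact .inl (s.trans (e.plug_err (.pairL .hole _)))
    have s := s.trans (e.plug (.pairL .hole _) ha'.1)
    rcases ih' hb with e | ⟨b', hb', e⟩
    · exact .inl (s.trans (e.plug_err (.pairR _ ha'.1 .hole)))
    · exact .inr ⟨_, ha'.pair hb', s.trans (e.plug (.pairR _ ha'.1 .hole) hb'.1)⟩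
  | @sum _ _ _ _ E E' h h' ih ih' =>
    intro v hv
    rcases ClosedVal.sum_inv hv with ⟨a, rfl, ha⟩ | ⟨a, rfl, ha⟩
    · have s := (sumCtx_steps_inl (E' := E') h ha.1).reduces
      rcases ih ha with e | ⟨w, hw, e⟩
      · exact .inl (s.trans (e.plug_err (.inl .hole)))
      · exact .inr ⟨_, hw.inl, s.trans (e.plug (.inl .hole) hw.1)⟩
    · have s := (sumCtx_steps_inr (E := E) h' ha.1).reduces
      rcases ih' ha with e | ⟨w, hw, e⟩
      · exact .inl (s.trans (e.plug_err (.inr .hole)))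
      · exact .inr ⟨_, hw.inr, s.trans (e.plug (.inr .hole) hw.1)⟩
  | arr h h' _ _ =>
    intro v hv
    obtain ⟨_, _, -, -, hF⟩ := (h.arr h').arr_inv
    obtain ⟨u, hu, s, -⟩ := hF v hv
    exact .inr ⟨u, hu, s.reduces⟩
  | @tag A G E _ _ ih =>
    intro v hv
    rw [ECtx.plug_comp]
    rcases ih hv with e | ⟨w, hw, e⟩
    · exact .inl (e.plug_err _)
    · exact .inr ⟨_, hw.inj, e.plug (tagCtx G) hw.1⟩
  | @untag B G E _ h ih =>
    intro v hv
    rw [ECtx.plug_comp]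
    obtain ⟨G', w, rfl, hw⟩ := ClosedVal.dyn_inv hv
    by_cases hG : G' = G
    · subst hG
      have s := (untagCtx_steps_self (G := G') hw.1).reduces.plug E hw.1
      exact (ih hw).imp s.trans fun ⟨u, hu, e⟩ => ⟨u, hu, s.trans e⟩
    · exact .inl ((untagCtx_steps_ne hG hw.1).reduces.plug_err E)
  | fail => exact fun hv => .inl (Red.letin hv.1).steps.reduces

end Impl

/-! ## Casts preserve the relation -/

/-- Height of a canonical derivation. -/
def Deriv.height : {A B : GTy} → Deriv A B → ℕ
  | _, _, .idUnit => 0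
  | _, _, .idDyn => 0
  | _, _, .tag _ _ c => c.height + 1
  | _, _, .prod c d => max c.height d.height + 1
  | _, _, .sum c d => max c.height d.height + 1
  | _, _, .arr c d => max c.height d.height + 1

/-- In the induction for `castRel`, `id(?)` of height 0 is traded for the identity at a tag type;
this bounds the cost. -/
theorem Tag.height_id (G : Tag) : (Deriv.id G.ty).height ≤ 1 := by
  cases G <;> simp [Tag.ty, Deriv.id, Deriv.height]

namespace SemTy

/-- A value takes no counted step, so the full index `i` remains, however much weight the left term
spends. -/
theorem tm_right_value {A₁ A₂ : Ty 0} {R : SemTy .succ A₁ A₂} {i : ℕ} {t v : Tm}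
    (h : R.tm i t v) (hv : IsValue v) :
    Reduces t .err ∨ ∃ w, Reduces t w ∧ R.rel i w v := by
  rcases h with ⟨t', h⟩ | ⟨j, -, h, -⟩ | ⟨j, -, v', -, h, h'⟩
  · exact absurd (hv.steps h).1 i.succ_ne_zero
  · exact absurd (hv.steps h).2.symm hv.ne_err
  · obtain ⟨rfl, rfl⟩ := hv.steps h
    exact h'

theorem tm_of_right_value {A₁ A₂ : Ty 0} {R : SemTy .succ A₁ A₂} {i : ℕ} {t v : Tm}
    (hv : ClosedVal A₂ v) (h : Reduces t .err ∨ ∃ w, Reduces t w ∧ R.rel i w v) : R.tm i t v :=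
  .inr (.inr ⟨0, i.zero_le, v, hv, .refl v, h⟩)

end SemTy

/-- Casts along `A₁ ⊑ A₂` and `B₁ ⊑ B₂` map related values to related terms. -/
def CastRel {A₁ A₂ B₁ B₂ : GTy} (c : Deriv A₁ A₂) (d : Deriv B₁ B₂) : Prop :=
  ∀ {F₁ F₂ : ECtx}, Impl A₁ B₁ F₁ → Impl A₂ B₂ F₂ → ∀ {side : Side} {i : ℕ} {v₁ v₂ : Tm},
    (c.sem side).rel i v₁ v₂ → (d.sem side).tm i (F₁.plug v₁) (F₂.plug v₂)

section

variable {A₁ A₂ A₁' A₂' B₁ B₂ B₁' B₂' : GTy}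
variable {c : Deriv A₁ A₂} {c' : Deriv A₁' A₂'} {d : Deriv B₁ B₂} {d' : Deriv B₁' B₂'}

theorem CastRel.prod (h : CastRel c d) (h' : CastRel c' d') :
    CastRel (c.prod c') (d.prod d') := by
  rintro F₁ F₂ hF₁ hF₂ side i _ _ ⟨a₁, b₁, a₂, b₂, rfl, rfl, ha, hb⟩
  obtain ⟨E₁, E₁', hE₁, hE₁', s₁⟩ := hF₁.prod_inv
  obtain ⟨E₂, E₂', hE₂, hE₂', s₂⟩ := hF₂.prod_inv
  have ca₂ := (c.sem side).closed_right ha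
  have cb₂ := (c'.sem side).closed_right hb
  exact SemTy.tm_of_steps_zero
    (s₁ _ _ ((c.sem side).closed_left ha).1 ((c'.sem side).closed_left hb).1)
    (s₂ _ _ ca₂.1 cb₂.1)
    (SemTy.tm_pair (h hE₁ hE₂ ha) (fun j hj => h' hE₁' hE₂' ((c'.sem side).mono hj hb))
      (hE₂.hasTy ca₂.2) (hE₂'.hasTy cb₂.2))

theorem CastRel.sum (h : CastRel c d) (h' : CastRel c' d') :
    CastRel (c.sum c') (d.sum d') := by
  rintro F₁ F₂ hF₁ hF₂ side i _ _ (⟨a₁, a₂, rfl, rfl, ha⟩ | ⟨a₁, a₂, rfl, rfl, ha⟩)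
  all_goals
    obtain ⟨E₁, E₁', hE₁, hE₁', s₁, s₁'⟩ := hF₁.sum_inv
    obtain ⟨E₂, E₂', hE₂, hE₂', s₂, s₂'⟩ := hF₂.sum_inv
  · have ca₂ := (c.sem side).closed_right ha
    exact SemTy.tm_of_steps_zero (s₁ _ ((c.sem side).closed_left ha).1) (s₂ _ ca₂.1)
      (SemTy.tm_inl (h hE₁ hE₂ ha) (hE₂.hasTy ca₂.2))
  · have ca₂ := (c'.sem side).closed_right ha
    exact SemTy.tm_of_steps_zero (s₁' _ ((c'.sem side).closed_left ha).1) (s₂' _ ca₂.1)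
      (SemTy.tm_inr (h' hE₁' hE₂' ha) (hE₂'.hasTy ca₂.2))

/-- Arguments are cast backwards, from the target domain to the source domain, which is why the
first hypothesis has `d` and `c` exchanged and the induction measure must be symmetric in them. -/
theorem CastRel.arr (h : CastRel d c) (h' : CastRel c' d') :
    CastRel (c.arr c') (d.arr d') := by
  intro F₁ F₂ hF₁ hF₂ side i v₁ v₂ hv
  obtain ⟨E₁, E₁', hE₁, hE₁', s₁⟩ := hF₁.arr_inv
  obtain ⟨E₂, E₂', hE₂, hE₂', s₂⟩ := hF₂.arr_inv
  obtain ⟨cv₁, cv₂, hv⟩ := hv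
  obtain ⟨u₁, cu₁, s₁, r₁⟩ := s₁ v₁ cv₁
  obtain ⟨u₂, cu₂, s₂, r₂⟩ := s₂ v₂ cv₂
  refine SemTy.tm_of_steps_zero s₁ s₂ (SemTy.tm_of_rel ⟨cu₁, cu₂, fun j hj w₁ w₂ hw => ?_⟩)
  have cw₂ := (d.sem side).closed_right hw
  have tw₂ := hE₂.hasTy cw₂.2
  refine SemTy.tm_of_steps_zero (r₁ _ ((d.sem side).closed_left hw).1) (r₂ _ cw₂.1) ?_
  refine SemTy.tm_bind (R := c'.sem side) E₁' E₂' ?_ (hE₂'.hasTy (.app cv₂.2 tw₂))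
    fun k _ x₁ x₂ hx => h' hE₁' hE₂' hx
  exact SemTy.tm_bind (.appR v₁ cv₁.1 .hole) (.appR v₂ cv₂.1 .hole) (h hE₁ hE₂ hw)
    (.app cv₂.2 tw₂) fun k hk x₁ x₂ hx => hv k (hk.trans hj) x₁ x₂ hx

end

/-- Casts between types with the same outermost connective, given the casts between their
components. -/
theorem castRel_of_tag? {A₁ A₂ B₁ B₂ : GTy} {G : Tag} (c : Deriv A₁ A₂) (d : Deriv B₁ B₂)
    (hA : A₂.tag? = some G) (hB : B₂.tag? = some G)
    (ih : ∀ {A₁ A₂ B₁ B₂ : GTy} (c' : Deriv A₁ A₂) (d' : Deriv B₁ B₂),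
      c'.height + d'.height + 2 ≤ c.height + d.height → CastRel c' d') : CastRel c d := by
  cases c with
  | idUnit =>
    cases hA
    cases d <;> cases hB
    intro F₁ F₂ hF₁ hF₂ side i v₁ v₂ hv
    rw [hF₁.unit_inv, hF₂.unit_inv]
    exact SemTy.tm_of_rel hv
  | idDyn | tag => cases hA
  | prod c c' =>
    cases hA
    cases d <;> cases hB
    exact CastRel.prod (ih _ _ (by simp only [Deriv.height]; omega))
      (ih _ _ (by simp only [Deriv.height]; omega))
  | sum c c' =>
    cases hA
    cases d <;> cases hB
    exact CastRel.sum (ih _ _ (by simp only [Deriv.height]; omega))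
      (ih _ _ (by simp only [Deriv.height]; omega))
  | arr c c' =>
    cases hA
    cases d <;> cases hB
    exact CastRel.arr (ih _ _ (by simp only [Deriv.height]; omega))
      (ih _ _ (by simp only [Deriv.height]; omega))

/-! ### Tagging and untagging related values. -/

namespace SemTy

variable {side : Side} {A₁ : Ty 0} {G : Tag} {R : SemTy side A₁ G.ty.tr} {i : ℕ} {t₁ t₂ : Tm}

theorem tag_rel_inj {v₁ v₂ : Tm} (h : R.rel (side.pred i) v₁ v₂) :
    (R.tag G).rel i v₁ (G.inj v₂) :=
  ⟨R.closed_left h, (R.closed_right h).inj, .inr ⟨v₂, rfl, h⟩⟩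

theorem tm_tag (h : R.tm i t₁ t₂) (ht : HasTy [] t₂ G.ty.tr) : (R.tag G).tm i t₁ (G.inj t₂) :=
  tm_bind .hole (tagCtx G) h (Tag.inj_hasTy ht) fun j _ v₁ v₂ hv =>
    tm_of_rel (t₁ := v₁) (t₂ := G.inj v₂)
      (tag_rel_inj (R.mono (by cases side <;> simp [Side.pred]) hv))

theorem rel_inj_inj {v₁ v₂ : Tm} (h : (ofTy side G.ty.tr).rel i v₁ v₂) :
    (ofTy side dynTy).rel (i + 1) (G.inj v₁) (G.inj v₂) :=
  valRel_dyn_succ.2 ⟨G, v₁, v₂, rfl, rfl, h⟩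

theorem tm_inj_inj (h : (ofTy side G.ty.tr).tm i t₁ t₂) (ht : HasTy [] t₂ G.ty.tr) :
    (ofTy side dynTy).tm i (G.inj t₁) (G.inj t₂) :=
  tm_bind (tagCtx G) (tagCtx G) h (Tag.inj_hasTy ht) fun j _ v₁ v₂ hv =>
    tm_of_rel (t₁ := G.inj v₁) (t₂ := G.inj v₂) ((ofTy side dynTy).mono j.le_succ (rel_inj_inj hv))

end SemTy

/-- Both sides unroll exactly once. Either the index is exhausted, or the tags agree, and then both
untaggings fail or both return related contents. -/
theorem SemTy.tm_untag_untag {side : Side} {G : Tag} {i : ℕ} {v₁ v₂ : Tm}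
    (h : (ofTy side dynTy).rel i v₁ v₂) :
    (ofTy side G.ty.tr).tm i ((untagCtx G).plug v₁) ((untagCtx G).plug v₂) := by
  obtain ⟨G₁, w₁, rfl, hw₁⟩ := (ValRel.closed_left h).dyn_inv
  obtain ⟨G₂, w₂, rfl, hw₂⟩ := (ValRel.closed_right h).dyn_inv
  refine tm_of_steps_one (untagCtx_steps hw₁.1) (untagCtx_steps hw₂.1) ?_
  rintro k rfl
  obtain ⟨G', _, _, e₁, e₂, hw⟩ := valRel_dyn_succ.1 h
  obtain ⟨rfl, rfl⟩ := Tag.inj_injective e₁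
  obtain ⟨rfl, rfl⟩ := Tag.inj_injective e₂
  by_cases hG : G₂ = G
  · subst hG
    rw [if_pos rfl, if_pos rfl]
    exact tm_of_rel hw
  · rw [if_neg hG, if_neg hG]
    exact tm_err _

/-- Only the right side unrolls. This is free on `prec`; on `succ` the cost is exactly the index
withheld by `Side.pred`. -/
theorem SemTy.tm_untag {side : Side} {A : Ty 0} {G : Tag} {R : SemTy side A G.ty.tr} {i : ℕ}
    {v₁ v₂ : Tm} (h : (R.tag G).rel i v₁ v₂) : R.tm i v₁ ((untagCtx G).plug v₂) := by
  obtain ⟨-, h₂, ⟨rfl, rfl⟩ | ⟨w, rfl, hw⟩⟩ := h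
  · obtain ⟨G', w, rfl, hw⟩ := h₂.dyn_inv
    exact .inl ⟨_, untagCtx_steps hw.1⟩
  · have s := untagCtx_steps_self (G := G) (R.closed_right hw).1
    cases side with
    | prec => exact tm_of_steps (j := 0) ⟨.refl _, s.reduces⟩ (tm_of_rel hw)
    | succ =>
      cases i with
      | zero => exact .inl ⟨_, s⟩
      | succ k => exact tm_of_steps (side := .succ) (j := 1) ⟨s, .refl _⟩ (tm_of_rel hw)

/-- Even at index 0, once the right side is a value the `succ` half requires the left side to fail
or return; totality of casts provides this. -/
theorem Impl.tm_zero {A B : GTy} {F : ECtx} {C : Ty 0} {R : SemTy .succ B.tr C} {v₁ v₂ : Tm}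
    (hF : Impl A B F) (h₁ : ClosedVal A.tr v₁) (h₂ : ClosedVal C v₂)
    (h : ∀ w, ClosedVal B.tr w → R.rel 0 w v₂) : R.tm 0 (F.plug v₁) v₂ :=
  SemTy.tm_of_right_value h₂ ((hF.total h₁).imp_right fun ⟨w, hw, s⟩ => ⟨w, s, h w hw⟩)

/-- The failing cast is related to every well-typed term. -/
theorem SemTy.tm_fail {side : Side} {A₁ A₂ : Ty 0} (R : SemTy side A₁ A₂) {i : ℕ} {v t : Tm}
    (hv : IsValue v) (ht : HasTy [] t A₂) : R.tm i ((ECtx.letin .hole .err).plug v) t :=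
  tm_of_left_err R i.zero_le (Red.letin hv).steps ht

/-- Casts along type dynamism preserve the relation. -/
theorem castRel_of_height (n : ℕ) : ∀ {A₁ A₂ B₁ B₂ : GTy} (c : Deriv A₁ A₂) (d : Deriv B₁ B₂),
    c.height + d.height ≤ n → CastRel c d := by
  induction n using Nat.strong_induction_on with
  | _ n IH =>
  -- Passing to components removes a constructor from both derivations, hence 2 from the sum of
  -- heights. The bound `n + 1` therefore suffices, which leaves room to replace `id(?)` by the
  -- identity at a tag type.
  have core : ∀ {A₁ A₂ B₁ B₂ : GTy} {G : Tag} (c : Deriv A₁ A₂) (d : Deriv B₁ B₂),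
      A₂.tag? = some G → B₂.tag? = some G → c.height + d.height ≤ n + 1 → CastRel c d :=
    fun c d hA hB hn => castRel_of_tag? c d hA hB fun c' d' h' => IH (n - 1) (by omega) c' d'
      (by omega)
  intro A₁ A₂ B₁ B₂ c d hn F₁ F₂ hF₁ hF₂ side i v₁ v₂ hv
  have cv₁ := (c.sem side).closed_left hv
  have cv₂ := (c.sem side).closed_right hv
  have ty₂ := hF₂.hasTy cv₂.2
  cases hA₂ : A₂.tag? with
  | some G =>
    have hA₁ := c.tag?_eq hA₂
    cases hB₂ : B₂.tag? with
    | some G' =>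
      have hB₁ := d.tag?_eq hB₂
      by_cases hG : G = G'
      · subst hG
        exact core c d hA₂ hB₂ (by omega) hF₁ hF₂ hv
      -- Tags are inherited from above, so the left cast also runs between distinct tags and fails.
      · rw [hF₁.fail_inv hA₁ hB₁ hG, hF₂.fail_inv hA₂ hB₂ hG] at *
        exact SemTy.tm_fail _ cv₁.1 ty₂
    | none =>
      cases d with
      | idUnit | prod | sum | arr => cases hB₂
      | idDyn =>
        obtain ⟨E₁, rfl, hE₁⟩ := hF₁.to_dyn_inv hA₁
        obtain ⟨E₂, rfl, hE₂⟩ := hF₂.to_dyn_inv hA₂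
        -- Both casts into `?` factor through the tag type of `G`, where the target relation is the
        -- reflexive one.
        have h := core c (Deriv.id G.ty) hA₂ (tag?_ty G)
          (by have := G.height_id; simp only [Deriv.height] at hn; omega) hE₁ hE₂ hv
        rw [Deriv.sem_id] at h
        rw [ECtx.plug_comp, ECtx.plug_comp]
        exact SemTy.tm_inj_inj h (hE₂.hasTy cv₂.2)
      | tag G' hB₁ d =>
        obtain ⟨E₂, rfl, hE₂⟩ := hF₂.to_dyn_inv hA₂
        by_cases hG : G = G'
        · subst hG
          rw [ECtx.plug_comp]
          simp only [Deriv.height] at hn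
          exact SemTy.tm_tag (core c d hA₂ (tag?_ty G) (by omega) hF₁ hE₂ hv) (hE₂.hasTy cv₂.2)
        · rw [hF₁.fail_inv hA₁ hB₁ hG]
          exact SemTy.tm_fail _ cv₁.1 ty₂
  | none =>
    cases hB₂ : B₂.tag? with
    | some G' =>
      have hB₁ := d.tag?_eq hB₂
      cases c with
      | idUnit | prod | sum | arr => cases hA₂
      | idDyn =>
        obtain ⟨E₁, rfl, hE₁⟩ := hF₁.from_dyn_inv hB₁
        obtain ⟨E₂, rfl, hE₂⟩ := hF₂.from_dyn_inv hB₂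
        have core := @core _ _ _ _ _ (Deriv.id G'.ty) d (tag?_ty G') hB₂
          (by have := G'.height_id; simp only [Deriv.height] at hn; omega) _ _ hE₁ hE₂ side
        rw [Deriv.sem_id] at core
        rw [ECtx.plug_comp] at ty₂ ⊢
        rw [ECtx.plug_comp]
        exact SemTy.tm_bind E₁ E₂ (SemTy.tm_untag_untag hv) ty₂ fun _ _ _ _ hw => core hw
      | tag G hA₁ c =>
        obtain ⟨E₂, rfl, hE₂⟩ := hF₂.from_dyn_inv hB₂
        by_cases hG : G = G'
        · subst hG
          simp only [Deriv.height] at hn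
          rw [ECtx.plug_comp] at ty₂ ⊢
          exact SemTy.tm_bind F₁ E₂ (SemTy.tm_untag hv) ty₂ fun _ _ _ _ hw =>
            core c d (tag?_ty G) hB₂ (by omega) hF₁ hE₂ hw
        · rw [hF₁.fail_inv hA₁ hB₁ hG]
          exact SemTy.tm_fail _ cv₁.1 ty₂
    | none =>
      -- Both types on the right are `?`, so the right side does nothing, and the left cast is
      -- compared with the identity at the tag type.
      have := hF₂.eq_hole hA₂ hB₂
      subst this
      cases c with
      | idUnit | prod | sum | arr => cases hA₂
      | idDyn =>
        cases d with
        | idUnit | prod | sum | arr => cases hB₂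
        | idDyn =>
          rw [hF₁.eq_hole rfl rfl]
          exact SemTy.tm_of_rel hv
        | tag G hB₁ d =>
          obtain ⟨E₁, rfl, hE₁⟩ := hF₁.from_dyn_inv hB₁
          have core := @core _ _ _ _ _ (Deriv.id G.ty) d (tag?_ty G) (tag?_ty G)
            (by have := G.height_id; simp only [Deriv.height] at hn; omega) _ _ hE₁ (.hole _) side
          rw [Deriv.sem_id] at core
          obtain ⟨G₁, w₁, rfl, hw₁⟩ := ClosedVal.dyn_inv cv₁
          cases i with
          | zero =>
            cases side with
            | prec =>
              rw [ECtx.plug_comp]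
              exact .inl ((untagCtx_steps hw₁.1).plug_exists E₁)
            | succ => exact hF₁.tm_zero cv₁ cv₂ fun w hw => ⟨hw, cv₂, .inl ⟨rfl, rfl⟩⟩
          | succ k =>
            obtain ⟨G', _, w₂, e₁, rfl, hw⟩ := valRel_dyn_succ.1 hv
            obtain ⟨rfl, rfl⟩ := Tag.inj_injective e₁
            rw [ECtx.plug_comp]
            by_cases hG : G₁ = G
            · subst hG
              -- The left untagging has weight 1. On `prec` this is the index lost between the
              -- values of `?` and their contents. On `succ` it is not counted, and the lost index
              -- is the one that `Side.pred` withholds.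
              have s := (untagCtx_steps_self (G := G₁) hw₁.1).plug E₁ hw₁.1.ne_err
              have hw' := core hw
              have cw₂ := ValRel.closed_right hw
              cases side with
              | prec =>
                exact SemTy.tm_of_steps (side := .prec) (j := 1) ⟨s, .refl _⟩
                  (SemTy.tm_tag hw' cw₂.2)
              | succ =>
                exact SemTy.tm_of_right_value cv₂
                  ((SemTy.tm_right_value hw' cw₂.1).imp s.reduces.trans fun ⟨u, r, hu⟩ =>
                    ⟨u, s.reduces.trans r, SemTy.tag_rel_inj hu⟩)
            · exact SemTy.tm_of_left_err _ (Nat.succ_le_succ k.zero_le)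
                ((untagCtx_steps_ne hG hw₁.1).plug_err E₁) cv₂.2
      | tag G hA₁ c =>
        cases d with
        | idUnit | prod | sum | arr => cases hB₂
        | idDyn =>
          obtain ⟨E₁, rfl, hE₁⟩ := hF₁.to_dyn_inv hA₁
          have core := @core _ _ _ _ _ c (Deriv.id G.ty) (tag?_ty G) (tag?_ty G)
            (by have := G.height_id; simp only [Deriv.height] at hn; omega) _ _ hE₁ (.hole _) side
          rw [Deriv.sem_id] at core
          obtain ⟨-, -, ⟨rfl, rfl⟩ | ⟨w, rfl, hw⟩⟩ := hv
          · exact hF₁.tm_zero cv₁ cv₂ fun w hw => valRel_mu_zero.2 ⟨hw, cv₂⟩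
          have cw := (c.sem side).closed_right hw
          have hw' := core hw
          rw [ECtx.plug_comp]
          cases side with
          | prec => exact SemTy.tm_inj_inj hw' cw.2
          | succ =>
            refine SemTy.tm_of_right_value cv₂
              ((SemTy.tm_right_value hw' cw.1).imp (Reduces.plug_err _) ?_)
            rintro ⟨u, r, hu⟩
            refine ⟨_, r.plug (tagCtx G) (ValRel.closed_left hu).1, ?_⟩
            -- The contents are related at `i - 1` and tagging adds one; with truncated subtraction
            -- the result is at least `i`.
            exact (SemTy.ofTy .succ dynTy).mono (by simp only [Side.pred]; omega)
              (SemTy.rel_inj_inj hu)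
        | tag G' hB₁ d =>
          by_cases hG : G = G'
          · subst hG
            obtain ⟨-, -, ⟨rfl, rfl⟩ | ⟨w, rfl, hw⟩⟩ := hv
            · exact hF₁.tm_zero cv₁ cv₂ fun w hw => ⟨hw, cv₂, .inl ⟨rfl, rfl⟩⟩
            have cw := (c.sem side).closed_right hw
            have hw' := core c d (tag?_ty G) (tag?_ty G)
              (by simp only [Deriv.height] at hn; omega) hF₁ (.hole _) hw
            cases side with
            | prec => exact SemTy.tm_tag hw' cw.2
            | succ =>
              exact SemTy.tm_of_right_value cv₂ ((SemTy.tm_right_value hw' cw.1).imp_right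
                fun ⟨u, r, hu⟩ => ⟨u, r, SemTy.tag_rel_inj hu⟩)
          · rw [hF₁.fail_inv hA₁ hB₁ hG]
            exact SemTy.tm_fail _ cv₁.1 ty₂

theorem castRel {A₁ A₂ B₁ B₂ : GTy} (c : Deriv A₁ A₂) (d : Deriv B₁ B₂) : CastRel c d :=
  castRel_of_height _ c d le_rfl

/-! ## Term dynamism is sound -/

theorem Deriv.tyDyn {A B : GTy} (c : Deriv A B) : TyDyn A B := by
  induction c with
  | idUnit | idDyn => exact .refl _
  | tag => exact .top _
  | prod _ _ ih ih' => exact .prod ih ih'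
  | sum _ _ ih ih' => exact .sum ih ih'
  | arr _ _ ih ih' => exact .arr ih ih'

theorem EnvDyn.getElem?_left {Γ₁ Γ₂ : List GTy} (h : EnvDyn Γ₁ Γ₂) : ∀ {n : ℕ} {A₁ : GTy},
    Γ₁[n]? = some A₁ → ∃ A₂, Γ₂[n]? = some A₂ ∧ TyDyn A₁ A₂ := by
  induction h with
  | nil => intro n A h; cases h
  | @cons _ _ _ A₂ _ hA ih =>
    intro n A h
    cases n with
    | zero => cases h; exact ⟨A₂, rfl, hA⟩
    | succ n => exact ih h

theorem EnvDyn.getElem?_right {Γ₁ Γ₂ : List GTy} (h : EnvDyn Γ₁ Γ₂) : ∀ {n : ℕ} {A₂ : GTy},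
    Γ₂[n]? = some A₂ → ∃ A₁, Γ₁[n]? = some A₁ ∧ TyDyn A₁ A₂ := by
  induction h with
  | nil => intro n A h; cases h
  | @cons _ _ A₁ _ _ hA ih =>
    intro n A h
    cases n with
    | zero => cases h; exact ⟨A₁, rfl, hA⟩
    | succ n => exact ih h

namespace TermDyn

variable {Γ₁ Γ₂ : List GTy} {t₁ t₂ : GTm} {A₁ A₂ : GTy}

theorem envDyn_tyDyn (h : TermDyn Γ₁ Γ₂ t₁ t₂ A₁ A₂) : EnvDyn Γ₁ Γ₂ ∧ TyDyn A₁ A₂ := by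
  induction h with
  | cast _ hB ih => exact ⟨ih.1, hB⟩
  | var hΓ h₁ h₂ =>
    obtain ⟨A, hA, h⟩ := hΓ.getElem?_left h₁
    cases hA.symm.trans h₂
    exact ⟨hΓ, h⟩
  | unit hΓ => exact ⟨hΓ, .refl _⟩
  | pair _ _ ih ih' => exact ⟨ih.1, .prod ih.2 ih'.2⟩
  | letpair _ _ ih ih' => exact ⟨ih.1, ih'.2⟩
  | inl _ h ih => exact ⟨ih.1, .sum ih.2 h⟩
  | inr _ h ih => exact ⟨ih.1, .sum h ih.2⟩
  | case _ _ _ ih ih' _ => exact ⟨ih.1, ih'.2⟩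
  | lam _ ih => exact ⟨ih.1.tail, .arr ih.1.head ih.2⟩
  | app _ _ ih _ =>
    refine ⟨ih.1, ?_⟩
    -- Transitivity prevents inverting `TyDyn` directly; a canonical derivation between function
    -- types can only end in `arr`.
    obtain ⟨c⟩ := ih.2.nonempty_deriv
    cases c with
    | arr _ d => exact d.tyDyn

theorem hasTy (h : TermDyn Γ₁ Γ₂ t₁ t₂ A₁ A₂) :
    HasTy (Γ₁.map GTy.tr) t₁.tr A₁.tr ∧ HasTy (Γ₂.map GTy.tr) t₂.tr A₂.tr := by
  induction h with
  | cast _ _ ih => exact ⟨(castCtx_impl _ _).hasTy ih.1, (castCtx_impl _ _).hasTy ih.2⟩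
  | var _ h₁ h₂ => exact ⟨.var (by simp [h₁]), .var (by simp [h₂])⟩
  | unit => exact ⟨.unit, .unit⟩
  | pair _ _ ih ih' => exact ⟨.pair ih.1 ih'.1, .pair ih.2 ih'.2⟩
  | letpair _ _ ih ih' => exact ⟨.letpair ih.1 ih'.1, .letpair ih.2 ih'.2⟩
  | inl _ _ ih => exact ⟨.inl ih.1, .inl ih.2⟩
  | inr _ _ ih => exact ⟨.inr ih.1, .inr ih.2⟩
  | case _ _ _ ih ih' ih'' => exact ⟨.case ih.1 ih'.1 ih''.1, .case ih.2 ih'.2 ih''.2⟩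
  | lam _ ih => exact ⟨.lam ih.1, .lam ih.2⟩
  | app _ _ ih ih' => exact ⟨.app ih.1 ih'.1, .app ih.2 ih'.2⟩

end TermDyn

/-- Related substitutions for environments that are related by type dynamism. -/
def EnvRel (side : Side) (i : ℕ) (Γ₁ Γ₂ : List GTy) (γ₁ γ₂ : ℕ → Tm) : Prop :=
  ∀ (n : ℕ) (A₁ A₂ : GTy), Γ₁[n]? = some A₁ → Γ₂[n]? = some A₂ → ∀ c : Deriv A₁ A₂,
    (c.sem side).rel i (γ₁ n) (γ₂ n)

namespace EnvRel

variable {side : Side} {i j : ℕ} {Γ₁ Γ₂ : List GTy} {γ₁ γ₂ : ℕ → Tm}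

theorem mono (hj : j ≤ i) (h : EnvRel side i Γ₁ Γ₂ γ₁ γ₂) : EnvRel side j Γ₁ Γ₂ γ₁ γ₂ :=
  fun n A₁ A₂ h₁ h₂ c => (c.sem side).mono hj (h n A₁ A₂ h₁ h₂ c)

theorem scons {A₁ A₂ : GTy} {v₁ v₂ : Tm} {c : Deriv A₁ A₂} (h : EnvRel side i Γ₁ Γ₂ γ₁ γ₂)
    (hv : (c.sem side).rel i v₁ v₂) :
    EnvRel side i (A₁ :: Γ₁) (A₂ :: Γ₂) (scons v₁ γ₁) (scons v₂ γ₂) := by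
  intro n B₁ B₂ h₁ h₂ d
  cases n with
  | zero =>
    cases h₁
    cases h₂
    -- The environment relation quantifies over all derivations, and uniqueness makes one of them
    -- enough.
    rwa [d.eq c]
  | succ n => exact h n B₁ B₂ h₁ h₂ d

theorem left (h : EnvRel side i Γ₁ Γ₂ γ₁ γ₂) (hΓ : EnvDyn Γ₁ Γ₂) (n : ℕ) (B : Ty 0)
    (hn : (Γ₁.map GTy.tr)[n]? = some B) : HasTy [] (γ₁ n) B := by
  rw [List.getElem?_map, Option.map_eq_some_iff] at hn
  obtain ⟨A₁, h₁, rfl⟩ := hn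
  obtain ⟨A₂, h₂, hA⟩ := hΓ.getElem?_left h₁
  exact ((hA.deriv.sem side).closed_left (h n _ _ h₁ h₂ _)).2

theorem right (h : EnvRel side i Γ₁ Γ₂ γ₁ γ₂) (hΓ : EnvDyn Γ₁ Γ₂) (n : ℕ) (B : Ty 0)
    (hn : (Γ₂.map GTy.tr)[n]? = some B) : HasTy [] (γ₂ n) B := by
  rw [List.getElem?_map, Option.map_eq_some_iff] at hn
  obtain ⟨A₂, h₂, rfl⟩ := hn
  obtain ⟨A₁, h₁, hA⟩ := hΓ.getElem?_right h₂
  exact ((hA.deriv.sem side).closed_right (h n _ _ h₁ h₂ _)).2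

end EnvRel

/-- Terms related by term dynamism are semantically related. -/
theorem TermDyn.sound {Γ₁ Γ₂ : List GTy} {t₁ t₂ : GTm} {A₁ A₂ : GTy}
    (h : TermDyn Γ₁ Γ₂ t₁ t₂ A₁ A₂) : ∀ (c : Deriv A₁ A₂) {side : Side} {i : ℕ}
      {γ₁ γ₂ : ℕ → Tm}, EnvRel side i Γ₁ Γ₂ γ₁ γ₂ →
      (c.sem side).tm i (t₁.tr.subst γ₁) (t₂.tr.subst γ₂) := by
  have ty : ∀ {Γ₁ Γ₂ t₁ t₂ A₁ A₂}, TermDyn Γ₁ Γ₂ t₁ t₂ A₁ A₂ → ∀ {side i γ₁ γ₂},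
      EnvRel side i Γ₁ Γ₂ γ₁ γ₂ → HasTy [] (t₂.tr.subst γ₂) A₂.tr :=
    fun h _ _ _ _ hγ => h.hasTy.2.subst (hγ.right h.envDyn_tyDyn.1)
  induction h with
  | @cast _ _ _ _ A₁ A₂ B₁ B₂ ht hB ih =>
    intro d side i γ₁ γ₂ hγ
    have h := castCtx_impl A₁ B₁
    have h' := castCtx_impl A₂ B₂
    have c := ht.envDyn_tyDyn.2.deriv
    simp only [GTm.tr]
    rw [h.subst_plug, h'.subst_plug]
    exact SemTy.tm_bind _ _ (ih c hγ) (h'.hasTy (ty ht hγ)) fun _ _ _ _ hv => castRel c d h h' hv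
  | var hΓ h₁ h₂ =>
    intro c side i γ₁ γ₂ hγ
    exact SemTy.tm_of_rel (hγ _ _ _ h₁ h₂ c)
  | unit hΓ =>
    intro c side i γ₁ γ₂ hγ
    cases c
    exact SemTy.tm_of_rel (valRel_unit.2 ⟨rfl, rfl⟩)
  | pair ht hs iht ihs =>
    intro c side i γ₁ γ₂ hγ
    cases c with
    | prod c d =>
      exact SemTy.tm_pair (iht c hγ) (fun j hj => ihs d (hγ.mono hj)) (ty ht hγ) (ty hs hγ)
  | letpair ht hs iht ihs =>
    intro d side i γ₁ γ₂ hγ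
    have c := ht.envDyn_tyDyn.2.deriv
    have hty := ty (.letpair ht hs) hγ
    cases c with
    | prod c c' =>
      refine SemTy.tm_letpair (iht (c.prod c') hγ) hty fun j hj v₁ v₂ w₁ w₂ hv hw => ?_
      rw [Tm.subst_up_up_double, Tm.subst_up_up_double]
      exact ihs d (((hγ.mono hj).scons hv).scons hw)
  | inl ht _ ih =>
    intro c side i γ₁ γ₂ hγ
    cases c with
    | sum c d => exact SemTy.tm_inl (ih c hγ) (ty ht hγ)
  | inr ht _ ih =>
    intro c side i γ₁ γ₂ hγ
    cases c with
    | sum c d => exact SemTy.tm_inr (ih d hγ) (ty ht hγ)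
  | case ht hs hs' iht ihs ihs' =>
    intro d side i γ₁ γ₂ hγ
    have c := ht.envDyn_tyDyn.2.deriv
    have hty := ty (.case ht hs hs') hγ
    cases c with
    | sum c c' =>
      refine SemTy.tm_case (iht (c.sum c') hγ) hty (fun j hj v₁ v₂ hv => ?_)
        fun j hj v₁ v₂ hv => ?_
      · rw [Tm.subst_up_single, Tm.subst_up_single]
        exact ihs d ((hγ.mono hj).scons hv)
      · rw [Tm.subst_up_single, Tm.subst_up_single]
        exact ihs' d ((hγ.mono hj).scons hv)
  | lam ht ih =>
    intro c side i γ₁ γ₂ hγ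
    have hΓ := ht.envDyn_tyDyn.1.tail
    cases c with
    | arr c d =>
      refine SemTy.tm_of_rel (SemTy.rel_lam (ht.hasTy.1.subst_up (hγ.left hΓ))
        (ht.hasTy.2.subst_up (hγ.right hΓ)) fun j hj v₁ v₂ hv => ?_)
      rw [Tm.subst_up_single, Tm.subst_up_single]
      exact ih d ((hγ.mono hj).scons hv)
  | app ht hs iht ihs =>
    intro d side i γ₁ γ₂ hγ
    have c := hs.envDyn_tyDyn.2.deriv
    exact SemTy.tm_app (iht (c.arr d) hγ) (fun j hj => ihs c (hγ.mono hj)) (ty ht hγ) (ty hs hγ)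

/-! ## Running a term on upcast inputs -/

theorem TyDyn.emb_impl {A B : GTy} (h : TyDyn A B) : Impl A B h.emb := h.deriv.ctx_impl.1

theorem EnvDyn.embs_length : ∀ {Γ₁ Γ₂ : List GTy} (h : EnvDyn Γ₁ Γ₂), h.embs.length = Γ₁.length
  | [], [], _ => rfl
  | _ :: _, _ :: _, h => congrArg Nat.succ h.tail.embs_length

theorem EnvDyn.getElem?_embs : ∀ {Γ₁ Γ₂ : List GTy} (h : EnvDyn Γ₁ Γ₂) {n : ℕ} {E : ECtx},
    h.embs[n]? = some E → ∃ A₁ A₂, Γ₁[n]? = some A₁ ∧ Γ₂[n]? = some A₂ ∧ TyDyn A₁ A₂ ∧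
      Impl A₁ A₂ E
  | [], [], _, _, _, hE => by cases hE
  | A₁ :: _, A₂ :: _, h, 0, _, hE => by
    cases hE
    exact ⟨A₁, A₂, rfl, rfl, h.head, h.head.emb_impl⟩
  | _ :: _, _ :: _, h, n + 1, E, hE => h.tail.getElem?_embs (n := n) hE

/-- The last context of the list gives the outermost `let`, so the arguments below use induction
from the end of the list. -/
theorem letEnv_append (n : ℕ) (Es : List ECtx) (E : ECtx) : ∀ t : Tm,
    letEnv n (Es ++ [E]) t = .letin (E.plug (.var (n - 1))) (letEnv n Es t) := by
  induction Es with
  | nil => intro t; rfl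
  | cons F Es ih => intro t; exact ih _

/-- Invariant, with `Es` the upcasts still to be bound: the `n - Es.length` variables bound so far
come first in `Δ`, followed by the original ones. Position `k` of the original environment is thus
found at `n - Es.length + k`, and its upcast, if already bound, at `k - Es.length`. -/
theorem letEnv_hasTy {Γ₁ Γ₂ : List GTy} {t : Tm} {B : Ty 0} {n : ℕ} (Es : List ECtx)
    (hEs : ∀ {k : ℕ} {E : ECtx}, Es[k]? = some E → ∃ A₁ A₂, Γ₁[k]? = some A₁ ∧
      Γ₂[k]? = some A₂ ∧ TyDyn A₁ A₂ ∧ Impl A₁ A₂ E)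
    (hn : Es.length ≤ n)
    (ht : ∀ {Δ : List (Ty 0)}, (∀ (k : ℕ) (A : GTy), Γ₂[k]? = some A → Δ[k]? = some A.tr) → HasTy Δ t B) :
    ∀ {Δ : List (Ty 0)},
      (∀ k < Es.length, ∀ A, Γ₁[k]? = some A → Δ[n - Es.length + k]? = some A.tr) →
      (∀ k, Es.length ≤ k → ∀ A, Γ₂[k]? = some A → Δ[k - Es.length]? = some A.tr) →
      HasTy Δ (letEnv n Es t) B := by
  induction Es using List.reverseRecOn with
  | nil => exact fun _ h => ht fun k A hk => h k k.zero_le A hk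
  | append_singleton Es E ih =>
    intro Δ h₁ h₂
    rw [List.length_append, List.length_singleton] at hn h₁ h₂
    obtain ⟨A₁, A₂, hA₁, hA₂, -, hE⟩ := hEs (k := Es.length) (E := E) (by simp)
    rw [letEnv_append]
    refine .letin (hE.hasTy (.var ?_)) (ih (fun {k E} hk => hEs ?_) (by omega) ?_ ?_)
    · convert h₁ _ (Nat.lt_succ_self _) _ hA₁ using 2
      omega
    · rw [List.getElem?_append_left (List.getElem?_eq_some_iff.1 hk).1]
      exact hk
    · intro k hk A hA
      have := h₁ k (by omega) A hA
      rwa [show n - Es.length + k = n - (Es.length + 1) + k + 1 by omega]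
    · intro k hk A hA
      rcases hk.eq_or_lt with rfl | hk
      · cases hA.symm.trans hA₂
        simp
      · have := h₂ k hk A hA
        rwa [show k - Es.length = k - (Es.length + 1) + 1 by omega]

/-- Only the right side has something to evaluate. The value `v` need not occur in `t₁`: it cannot
step or fail, and it serves to record what the result of `t₂` is related to. -/
theorem SemTy.tm_bind_right {side : Side} {A₁ A₂ B₁ B₂ : Ty 0} {R : SemTy side A₁ A₂}
    {S : SemTy side B₁ B₂} {i : ℕ} {v t₁ t₂ : Tm} (E : ECtx) (hv : IsValue v) (ht : R.tm i v t₂)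
    (h : ∀ j ≤ i, ∀ w, R.rel j v w → S.tm j t₁ (E.plug w)) : S.tm i t₁ (E.plug t₂) := by
  have err : ¬ Reduces v .err := fun ⟨_, h⟩ => hv.ne_err (hv.steps h).2.symm
  cases side with
  | prec =>
    rcases ht with ⟨t, s⟩ | ⟨k, -, s⟩ | ⟨k, -, v', w, hw, s, s'⟩
    · exact absurd (hv.steps s).1 i.succ_ne_zero
    · exact absurd s.reduces err
    · obtain ⟨rfl, rfl⟩ := hv.steps s
      exact tm_of_steps (side := .prec) (j := 0) ⟨.refl _, s'.plug E (R.closed_right hw).1⟩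
        (h i le_rfl w hw)
  | succ =>
    rcases ht with ⟨t, s⟩ | ⟨k, -, -, s⟩ | ⟨k, hk, w, -, s, s' | ⟨v', ⟨_, s'⟩, hw⟩⟩
    · exact .inl (s.plug_exists E)
    · exact absurd s err
    · exact absurd s' err
    · obtain ⟨-, rfl⟩ := hv.steps s'
      have := tm_of_steps (side := .succ) (j := k)
        ⟨s.plug E (R.closed_right hw).1.ne_err, .refl _⟩ (h (i - k) (by omega) w hw)
      rwa [Nat.sub_add_cancel hk] at this

theorem tm_letEnv {side : Side} {B₁ B₂ : Ty 0} {S : SemTy side B₁ B₂} {Γ₁ Γ₂ : List GTy}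
    {t₁ t : Tm} {γ₁ γ₂ : ℕ → Tm} {n : ℕ} (Es : List ECtx) :
    ∀ {i : ℕ}, (∀ {k : ℕ} {E : ECtx}, Es[k]? = some E → ∃ A₁ A₂, Γ₁[k]? = some A₁ ∧
      Γ₂[k]? = some A₂ ∧ TyDyn A₁ A₂ ∧ Impl A₁ A₂ E) →
    Es.length ≤ n → SubstRel side i (Γ₁.map GTy.tr) γ₁ γ₂ →
    (∀ j ≤ i, ∀ δ, EnvRel side j Γ₁ Γ₂ γ₁ δ → S.tm j t₁ (t.subst δ)) →
    ∀ {δ : ℕ → Tm}, (∀ k < Es.length, δ (n - Es.length + k) = γ₂ k) →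
      (∀ k, Es.length ≤ k → ∀ A₁ A₂, Γ₁[k]? = some A₁ → Γ₂[k]? = some A₂ →
        ∀ c : Deriv A₁ A₂, (c.sem side).rel i (γ₁ k) (δ (k - Es.length))) →
      S.tm i t₁ ((letEnv n Es t).subst δ) := by
  induction Es using List.reverseRecOn with
  | nil =>
    intro i _ _ _ ht δ _ h₂
    exact ht i le_rfl δ fun k => h₂ k k.zero_le
  | append_singleton Es E ih =>
    intro i hEs hn hγ ht δ h₁ h₂
    rw [List.length_append, List.length_singleton] at hn h₁ h₂
    obtain ⟨A₁, A₂, hA₁, hA₂, hA, hE⟩ := hEs (k := Es.length) (E := E) (by simp)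
    have hlast : δ (n - 1) = γ₂ Es.length := by
      rw [← h₁ _ (Nat.lt_succ_self _)]
      congr 1
      omega
    have hv : ValRel side i A₁.tr (γ₁ Es.length) (γ₂ Es.length) := hγ _ _ (by simp [hA₁])
    -- Upcasting on the right alone is a pair of casts from `A₁ ⊑ A₁` to `A₁ ⊑ A₂`, the left one
    -- being the identity.
    have hup := castRel (Deriv.id A₁) hA.deriv (.hole A₁) hE (side := side) (i := i)
      (v₁ := γ₁ Es.length) (v₂ := γ₂ Es.length) (by rw [Deriv.sem_id]; exact hv)
    rw [letEnv_append]
    simp only [Tm.subst]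
    rw [hE.subst_plug, Tm.subst, hlast]
    refine SemTy.tm_bind_right (.letin .hole _) hv.closed_left.1 hup fun j hj w hw => ?_
    refine SemTy.tm_of_steps_zero (.refl _)
      (Red.letin ((hA.deriv.sem side).closed_right hw).1).steps ?_
    rw [Tm.subst_up_single]
    refine ih (fun {k E} hk => hEs ?_) (by omega) (hγ.mono hj)
      (fun k hk => ht k (hk.trans hj)) ?_ ?_
    · rw [List.getElem?_append_left (List.getElem?_eq_some_iff.1 hk).1]
      exact hk
    · intro k hk
      rw [show n - Es.length + k = n - (Es.length + 1) + k + 1 by omega]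
      exact h₁ k (by omega)
    · intro k hk C₁ C₂ hC₁ hC₂ c
      rcases hk.eq_or_lt with rfl | hk
      · cases hC₁.symm.trans hA₁
        cases hC₂.symm.trans hA₂
        rw [Nat.sub_self, c.eq hA.deriv]
        exact hw
      · rw [show k - Es.length = k - (Es.length + 1) + 1 by omega]
        exact (c.sem side).mono hj (h₂ k hk C₁ C₂ hC₁ hC₂ c)

/-- Logical graduality. -/
theorem TermDyn.logTermDyn {Γ₁ Γ₂ : List GTy} {t₁ t₂ : GTm} {A₁ A₂ : GTy}
    (h : TermDyn Γ₁ Γ₂ t₁ t₂ A₁ A₂) : LogTermDyn Γ₁ Γ₂ t₁.tr t₂.tr A₁ A₂ := by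
  obtain ⟨hΓ, hA⟩ := h.envDyn_tyDyn
  obtain ⟨ty₁, ty₂⟩ := h.hasTy
  have hlen := hΓ.embs_length
  have tyE := hA.emb_impl.hasTy ty₁
  have tyL : HasTy (Γ₁.map GTy.tr) (letEnv Γ₁.length hΓ.embs t₂.tr) A₂.tr := by
    refine letEnv_hasTy hΓ.embs hΓ.getElem?_embs hlen.le (fun {Δ} hΔ => ?_) ?_ ?_
    · rw [← t₂.tr.subst_var]
      refine ty₂.subst fun k B hk => .var ?_
      rw [List.getElem?_map, Option.map_eq_some_iff] at hk
      obtain ⟨A, hk, rfl⟩ := hk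
      exact hΔ k A hk
    · intro k _ A hk
      simp [hlen, hk]
    · intro k hk A hA
      obtain ⟨A₁, hA₁, -⟩ := hΓ.getElem?_right hA
      have := (List.getElem?_eq_some_iff.1 hA₁).1
      omega
  refine ⟨ty₁, ty₂, hΓ, hA, tyE, tyL, fun side i γ₁ γ₂ hγ => termRel_iff.2 ⟨?_, ?_, ?_⟩⟩
  · exact tyE.subst fun n B hn => (hγ n B hn).closed_left.2
  · exact tyL.subst fun n B hn => (hγ n B hn).closed_right.2
  · rw [hA.emb_impl.subst_plug]
    refine tm_letEnv hΓ.embs hΓ.getElem?_embs hlen.le hγ (fun j _ δ hδ => ?_) ?_ ?_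
    -- Dually, upcasting on the left alone is a pair of casts from `A₁ ⊑ A₂` to `A₂ ⊑ A₂`, which
    -- lands in the homogeneous relation at `A₂`.
    · have := @castRel _ _ _ _ hA.deriv (Deriv.id A₂) _ _ hA.emb_impl (.hole A₂) side
      rw [Deriv.sem_id] at this
      exact SemTy.tm_bind hA.emb .hole (h.sound hA.deriv hδ) (ty₂.subst (hδ.right hΓ))
        fun _ _ _ _ hv => this hv
    · intro k _
      simp [hlen]
    · intro k hk C₁ C₂ hC₁
      have := (List.getElem?_eq_some_iff.1 hC₁).1
      omega

end Graduality

theorem mainTheorem2 {Γ₁ Γ₂ : List Graduality.GTy} {t₁ t₂ : Graduality.GTm}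
    {A₁ A₂ : Graduality.GTy} (h : Graduality.TermDyn Γ₁ Γ₂ t₁ t₂ A₁ A₂) :
    Graduality.LogTermDyn Γ₁ Γ₂ t₁.tr t₂.tr A₁ A₂ :=
  h.logTermDyn
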